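/- For $x\in(0,1]$ put $d_1(x)=\lfloor 1/x\rfloor+1$ and $\mathscr{L}(x)=d_1(x)(d_1(x)-1)x-(d_1(x)-1)\in(0,1]$, and let $d_n(x)=d_1(\mathscr{L}^{n-1}(x))$, $n\ge 1$, be the digits of the Lüroth expansion of $x$. Let $m\ge 1$ be an integer, let $\mathbf{t}=(t_0,\dots,t_{m-1})$ be a vector of positive real numbers, and let $\Psi:\{1,2,3,\dots\}\to(0,\infty)$ be any function. Define $$\mathcal{E}_{\mathbf t}(\Psi)=\Big\{x\in(0,1]:\ \prod_{i=0}^{m-1}d_{n+i}(x)^{t_i}\ge\Psi(n)\ \text{ for infinitely many } n\ge 1\Big\},$$ and define $B\in[0,\infty]$ by $\log B=\liminf_{n\to\infty}\frac{\log\Psi(n)}{n}$. Then: 1. If $B=1$, then $\dim_H\mathcal{E}_{\mathbf t}(\Psi)=1$. 2. If $B=\infty$, then $\Psi(n)>1$ for all large $n$; define $b\in[1,\infty]$ by $\log b=\liminf_{n\to\infty}\frac{\log\log\Psi(n)}{n}$. Then $\dim_H\mathcal{E}_{\mathbf t}(\Psi)=\frac{1}{b+1}$, where $\frac1{\infty}=0$.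 In particular, the dimension is $\frac12$ if $b=1$ and $0$ if $b=\infty$. Here $\dim_H$ denotes Hausdorff dimension. -/

import Mathlib

open Filter

noncomputable section

namespace LurothSeries

/-- The first Lüroth digit `d₁(x) = ⌊1/x⌋ + 1`; for `x ∈ (0,1]` it is the integer `d ≥ 2`
with `1/d < x ≤ 1/(d-1)`. -/
def firstDigit (x : ℝ) : ℕ := ⌊1 / x⌋₊ + 1

/-- The Lüroth map; it maps `(0,1]` to itself. -/
def lurothMap (x : ℝ) : ℝ :=
  if x = 0 then 0
  else (firstDigit x : ℝ) * ((firstDigit x : ℝ) - 1) * x - ((firstDigit x : ℝ) - 1)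

/-- The `n`-th Lüroth digit `dₙ(x) = d₁(𝓛ⁿ⁻¹(x))`, for `n ≥ 1`. -/
def digit (n : ℕ) (x : ℝ) : ℕ := firstDigit (lurothMap^[n - 1] x)

/-- The set of all `x ∈ (0,1]` such that `∏_{i<m} d_{n+i}(x)^{t_i} ≥ Ψ(n)` for infinitely
many integers `n ≥ 1`. -/
def limsupSet {m : ℕ} (t : Fin m → ℝ) (Ψ : ℕ → ℝ) : Set ℝ :=
  {x | x ∈ Set.Ioc (0 : ℝ) 1 ∧
    {n : ℕ | 1 ≤ n ∧ Ψ n ≤ ∏ i : Fin m, (digit (n + i) x : ℝ) ^ (t i)}.Infinite}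

/-- The number `B ∈ [0,∞]` with `log B = liminf (log Ψ(n)) / n`. The lower limit is taken in
`[-∞,∞]`, and `exp (-∞) = 0`, `exp ∞ = ∞`. -/
def growthB (Ψ : ℕ → ℝ) : ENNReal :=
  EReal.exp (liminf (fun n : ℕ => ((Real.log (Ψ n) / n : ℝ) : EReal)) atTop)

/-- The number `b ∈ [0,∞]` with `log b = liminf (log log Ψ(n)) / n`, the lower limit being
taken in `[-∞,∞]`. It is used only if `B = ∞`; then `Ψ(n) > 1` for all large `n`, so that
`log log Ψ(n)` is meaningful for all large `n`. -/
def growthb (Ψ : ℕ → ℝ) : ENNReal :=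
  EReal.exp (liminf (fun n : ℕ => ((Real.log (Real.log (Ψ n)) / n : ℝ) : EReal)) atTop)

end LurothSeries

end

/-! Lower bounds come from explicit families of series: a map `x ↦ lurothSum (e x)` on an interval,
with `s`-Hölder inverse, has an image of dimension at least `s`
(`mul_dimH_le_dimH_image_lurothSum`). It suffices to make one digit large, since the other factors
of the product are at least 1.

If `B = ∞` and `c > b`, then `Ψ n ≤ exp (c ^ n)` infinitely often, and every digit is left free in
`[K n, 2 * K n)` with `K n ≈ exp (l * c ^ n)`. Up to exponential factors, a cylinder has mass `∏ (K
i)⁻¹`, to be compared with the scale `∏ (K i)⁻² * (K n)⁻¹`. The logarithms are in the ratio of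
`1/(c-1)` to `2/(c-1) + 1`, which is `1/(c+1)`. If `B = 1`, digits of size `exp (O(ε n))`, inserted
at sparse positions into the expansion of an arbitrary point, cost arbitrarily little dimension.

For the upper bound, suppose `log (Ψ n) ≥ c₂ ^ n` eventually, with `c₂ > c > 1`. Then, for every
`A`, a point of the set has infinitely often a next digit at least `A ^ n * (d₁ ⋯ dₙ) ^ (c - 1)`;
otherwise its log-digits would be `O(c ^ n)`, too small for `Ψ`. Points with prefix `w` and such a
next digit lie within `2 * (2 / A) ^ n * ∏ wᵢ ^ (-(c + 1))` of each other. The sum of the `s`-th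
powers over all `w` is governed by the `n`-th power of a small multiple of `ζ(s * (c + 1))`, so the
covering works for `s > 1/(c+1)`. For `b = 1` the same covering is used with `c = 1`, where
superexponential growth is enough. -/

noncomputable section

namespace LurothSeries

/-! ### Lüroth series and their digits -/

open Finset in
/-- The sum of the Lüroth series with digits `d 0, d 1, …`. -/
def lurothSum (d : ℕ → ℕ) : ℝ :=
  ∑' n, (∏ i ∈ range n, ((d i : ℝ) * (d i - 1))⁻¹) * (d n : ℝ)⁻¹

lemma inv_mul_pred_pos {k : ℕ} (hk : 2 ≤ k) : 0 < ((k : ℝ) * (k - 1))⁻¹ := by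
  have : (2 : ℝ) ≤ k := by exact_mod_cast hk
  have : (0 : ℝ) < k - 1 := by linarith
  positivity

lemma inv_mul_pred_le_half {k : ℕ} (hk : 2 ≤ k) : ((k : ℝ) * (k - 1))⁻¹ ≤ 1 / 2 := by
  have : (2 : ℝ) ≤ k := by exact_mod_cast hk
  rw [one_div]
  apply inv_anti₀ (by norm_num)
  nlinarith

lemma inv_add_inv_mul_pred {k : ℕ} (hk : 2 ≤ k) :
    (k : ℝ)⁻¹ + ((k : ℝ) * (k - 1))⁻¹ = ((k : ℝ) - 1)⁻¹ := by
  have : (2 : ℝ) ≤ k := by exact_mod_cast hk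
  have : (k : ℝ) - 1 ≠ 0 := by linarith
  field_simp
  ring

lemma inv_pred_le_one {k : ℕ} (hk : 2 ≤ k) : ((k : ℝ) - 1)⁻¹ ≤ 1 := by
  have : (2 : ℝ) ≤ k := by exact_mod_cast hk
  exact inv_le_one_of_one_le₀ (by linarith)

lemma prod_inv_mul_pred_pos {d : ℕ → ℕ} (hd : ∀ i, 2 ≤ d i) (n : ℕ) :
    0 < ∏ i ∈ Finset.range n, ((d i : ℝ) * (d i - 1))⁻¹ :=
  Finset.prod_pos fun i _ => inv_mul_pred_pos (hd i)

lemma prod_inv_mul_pred_le {d : ℕ → ℕ} (hd : ∀ i, 2 ≤ d i) (n : ℕ) :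
    ∏ i ∈ Finset.range n, ((d i : ℝ) * (d i - 1))⁻¹ ≤ (1 / 2) ^ n := by
  calc _ ≤ ∏ i ∈ Finset.range n, (1 / 2 : ℝ) :=
        Finset.prod_le_prod (fun i _ => (inv_mul_pred_pos (hd i)).le)
          fun i _ => inv_mul_pred_le_half (hd i)
    _ = _ := by simp

lemma summable_lurothSum {d : ℕ → ℕ} (hd : ∀ i, 2 ≤ d i) :
    Summable fun n => (∏ i ∈ Finset.range n, ((d i : ℝ) * (d i - 1))⁻¹) * (d n : ℝ)⁻¹ := by
  refine Summable.of_nonneg_of_le (fun n => ?_) (fun n => ?_)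
    (summable_geometric_of_lt_one (r := (1 / 2 : ℝ)) (by norm_num) (by norm_num))
  · have := prod_inv_mul_pred_pos hd n
    positivity
  · calc _ ≤ (1 / 2 : ℝ) ^ n * 1 := by
          apply mul_le_mul (prod_inv_mul_pred_le hd n) _ (by positivity) (by positivity)
          apply inv_le_one_of_one_le₀
          exact_mod_cast (by linarith [hd n] : 1 ≤ d n)
      _ = _ := mul_one _

lemma lurothSum_eq {d : ℕ → ℕ} (hd : ∀ i, 2 ≤ d i) :
    lurothSum d = (d 0 : ℝ)⁻¹ +
      ((d 0 : ℝ) * (d 0 - 1))⁻¹ * lurothSum (fun i => d (i + 1)) := by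
  unfold lurothSum
  rw [(summable_lurothSum hd).tsum_eq_zero_add, ← tsum_mul_left]
  simp only [Finset.range_zero, Finset.prod_empty, one_mul]
  congr 1
  refine tsum_congr fun n => ?_
  rw [Finset.prod_range_succ']
  ring

lemma lurothSum_nonneg {d : ℕ → ℕ} (hd : ∀ i, 2 ≤ d i) : 0 ≤ lurothSum d :=
  tsum_nonneg fun n => mul_nonneg (prod_inv_mul_pred_pos hd n).le (by positivity)

lemma inv_le_lurothSum {d : ℕ → ℕ} (hd : ∀ i, 2 ≤ d i) : (d 0 : ℝ)⁻¹ ≤ lurothSum d := by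
  rw [lurothSum_eq hd]
  have := mul_nonneg (inv_mul_pred_pos (hd 0)).le
    (lurothSum_nonneg (d := fun i => d (i + 1)) fun i => hd _)
  linarith

lemma lurothSum_pos {d : ℕ → ℕ} (hd : ∀ i, 2 ≤ d i) : 0 < lurothSum d := by
  refine lt_of_lt_of_le ?_ (inv_le_lurothSum hd)
  have := hd 0
  positivity

lemma lurothSum_le_one {d : ℕ → ℕ} (hd : ∀ i, 2 ≤ d i) : lurothSum d ≤ 1 := by
  refine (summable_lurothSum hd).tsum_le_of_sum_range_le fun n => ?_
  induction n generalizing d with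
  | zero => simp
  | succ n ih =>
    rw [Finset.sum_range_succ']
    have h := ih (d := fun i => d (i + 1)) fun i => hd _
    have h2 : ∑ k ∈ Finset.range n,
        (∏ i ∈ Finset.range (k + 1), ((d i : ℝ) * (d i - 1))⁻¹) * (d (k + 1) : ℝ)⁻¹ =
        ((d 0 : ℝ) * (d 0 - 1))⁻¹ * ∑ k ∈ Finset.range n,
          (∏ i ∈ Finset.range k, ((d (i + 1) : ℝ) * (d (i + 1) - 1))⁻¹) *
            (d (k + 1) : ℝ)⁻¹ := by
      rw [Finset.mul_sum]
      refine Finset.sum_congr rfl fun k _ => ?_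
      rw [Finset.prod_range_succ']
      ring
    rw [h2]
    have h3 := mul_le_mul_of_nonneg_left h (inv_mul_pred_pos (hd 0)).le
    simp only [Finset.range_zero, Finset.prod_empty, one_mul]
    linarith [inv_add_inv_mul_pred (hd 0), inv_pred_le_one (hd 0)]

lemma lurothSum_le_inv_pred {d : ℕ → ℕ} (hd : ∀ i, 2 ≤ d i) :
    lurothSum d ≤ ((d 0 : ℝ) - 1)⁻¹ := by
  rw [lurothSum_eq hd, ← inv_add_inv_mul_pred (hd 0)]
  have := mul_le_mul_of_nonneg_left (lurothSum_le_one (d := fun i => d (i + 1)) fun i => hd _)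
    (inv_mul_pred_pos (hd 0)).le
  linarith

lemma firstDigit_eq {x : ℝ} {k : ℕ} (hk : 2 ≤ k) (h1 : (k : ℝ)⁻¹ < x)
    (h2 : x ≤ ((k : ℝ) - 1)⁻¹) : firstDigit x = k := by
  have hk' : (2 : ℝ) ≤ k := by exact_mod_cast hk
  have hx : 0 < x := lt_trans (by positivity) h1
  obtain ⟨j, rfl⟩ : ∃ j, k = j + 1 := ⟨k - 1, by omega⟩
  unfold firstDigit
  congr 1
  rw [Nat.floor_eq_iff (by positivity)]
  push_cast at *
  rw [add_sub_cancel_right] at h2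
  rw [one_div]
  constructor
  · rw [le_inv_comm₀ (by linarith) hx]; exact h2
  · rw [inv_lt_comm₀ hx (by positivity)]; exact h1

lemma two_le_firstDigit {x : ℝ} (hx : x ∈ Set.Ioc (0 : ℝ) 1) : 2 ≤ firstDigit x := by
  unfold firstDigit
  have : 1 ≤ ⌊1 / x⌋₊ := by
    rw [Nat.one_le_floor_iff, le_div_iff₀ hx.1]
    linarith [hx.2]
  omega

lemma inv_firstDigit_lt {x : ℝ} (hx : x ∈ Set.Ioc (0 : ℝ) 1) : (firstDigit x : ℝ)⁻¹ < x := by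
  rw [inv_lt_comm₀ (by have := two_le_firstDigit hx; positivity) hx.1]
  have := Nat.lt_floor_add_one (1 / x)
  unfold firstDigit
  push_cast
  rwa [one_div] at this ⊢

lemma le_inv_firstDigit_pred {x : ℝ} (hx : x ∈ Set.Ioc (0 : ℝ) 1) :
    x ≤ ((firstDigit x : ℝ) - 1)⁻¹ := by
  have h2 : (2 : ℝ) ≤ firstDigit x := by exact_mod_cast two_le_firstDigit hx
  rw [le_inv_comm₀ hx.1 (by linarith)]
  have := Nat.floor_le (a := 1 / x) (by have := hx.1; positivity)
  unfold firstDigit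
  push_cast
  rw [add_sub_cancel_right]
  rwa [one_div] at this ⊢

lemma eq_firstDigit_add_lurothMap {x : ℝ} (hx : x ∈ Set.Ioc (0 : ℝ) 1) :
    x = (firstDigit x : ℝ)⁻¹ +
      ((firstDigit x : ℝ) * (firstDigit x - 1))⁻¹ * lurothMap x := by
  have h2 : (2 : ℝ) ≤ firstDigit x := by exact_mod_cast two_le_firstDigit hx
  have h3 : (firstDigit x : ℝ) - 1 ≠ 0 := by linarith
  rw [lurothMap, if_neg hx.1.ne']
  field_simp
  ring

lemma lurothMap_mem {x : ℝ} (hx : x ∈ Set.Ioc (0 : ℝ) 1) :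
    lurothMap x ∈ Set.Ioc (0 : ℝ) 1 := by
  have h0 := eq_firstDigit_add_lurothMap hx
  have h1 := inv_firstDigit_lt hx
  have h2 := le_inv_firstDigit_pred hx
  have h3 := inv_mul_pred_pos (two_le_firstDigit hx)
  rw [← inv_add_inv_mul_pred (two_le_firstDigit hx)] at h2
  constructor
  · by_contra h
    nlinarith
  · by_contra h
    nlinarith

lemma iterate_lurothMap_mem {x : ℝ} (hx : x ∈ Set.Ioc (0 : ℝ) 1) (n : ℕ) :
    lurothMap^[n] x ∈ Set.Ioc (0 : ℝ) 1 := by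
  induction n with
  | zero => exact hx
  | succ n ih => rw [Function.iterate_succ_apply']; exact lurothMap_mem ih

lemma firstDigit_lurothSum {d : ℕ → ℕ} (hd : ∀ i, 2 ≤ d i) :
    firstDigit (lurothSum d) = d 0 := by
  refine firstDigit_eq (hd 0) ?_ (lurothSum_le_inv_pred hd)
  rw [lurothSum_eq hd]
  have := mul_pos (inv_mul_pred_pos (hd 0))
    (lurothSum_pos (d := fun i => d (i + 1)) fun i => hd _)
  linarith

lemma lurothSum_mem {d : ℕ → ℕ} (hd : ∀ i, 2 ≤ d i) : lurothSum d ∈ Set.Ioc (0 : ℝ) 1 :=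
  ⟨lurothSum_pos hd, lurothSum_le_one hd⟩

lemma lurothMap_lurothSum {d : ℕ → ℕ} (hd : ∀ i, 2 ≤ d i) :
    lurothMap (lurothSum d) = lurothSum (fun i => d (i + 1)) := by
  have h0 := eq_firstDigit_add_lurothMap (lurothSum_mem hd)
  rw [firstDigit_lurothSum hd] at h0
  have h1 := lurothSum_eq hd
  exact mul_left_cancel₀ (inv_mul_pred_pos (hd 0)).ne' (by linarith)

lemma iterate_lurothMap_lurothSum {d : ℕ → ℕ} (hd : ∀ i, 2 ≤ d i) (n : ℕ) :
    lurothMap^[n] (lurothSum d) = lurothSum (fun i => d (n + i)) := by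
  induction n with
  | zero => simp
  | succ n ih =>
    rw [Function.iterate_succ_apply', ih, lurothMap_lurothSum fun i => hd _]
    congr 1
    ext i
    congr 1
    ring

lemma digit_succ_lurothSum {d : ℕ → ℕ} (hd : ∀ i, 2 ≤ d i) (n : ℕ) :
    digit (n + 1) (lurothSum d) = d n := by
  rw [digit, Nat.add_sub_cancel, iterate_lurothMap_lurothSum hd,
    firstDigit_lurothSum fun i => hd _, add_zero]

lemma lurothSum_sub_lurothSum {d e : ℕ → ℕ} (hd : ∀ i, 2 ≤ d i) (he : ∀ i, 2 ≤ e i) {n : ℕ}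
    (h : ∀ i < n, d i = e i) :
    lurothSum d - lurothSum e = (∏ i ∈ Finset.range n, ((d i : ℝ) * (d i - 1))⁻¹) *
      (lurothSum (fun i => d (n + i)) - lurothSum (fun i => e (n + i))) := by
  induction n with
  | zero => simp
  | succ n ih =>
    rw [ih fun i hi => h i (by omega), Finset.prod_range_succ,
      lurothSum_eq (d := fun i => d (n + i)) fun i => hd _,
      lurothSum_eq (d := fun i => e (n + i)) fun i => he _]
    simp only [add_zero, h n (by omega)]
    have (f : ℕ → ℕ) : (fun i => f (n + (i + 1))) = fun i => f (n + 1 + i) := by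
      ext i; congr 1; ring
    rw [this d, this e]
    ring

/-- If one large digit occurs infinitely often in the expansion, the sum of the series lies in
the limsup set. -/
lemma lurothSum_mem_limsupSet {m : ℕ} (hm : 1 ≤ m) {t : Fin m → ℝ} (ht : ∀ i, 0 < t i)
    {Ψ : ℕ → ℝ} {d : ℕ → ℕ} (hd : ∀ i, 2 ≤ d i)
    (h : ∃ᶠ n in atTop, Ψ (n + 1) ≤ (d n : ℝ) ^ t ⟨0, hm⟩) :
    lurothSum d ∈ limsupSet t Ψ := by
  refine ⟨lurothSum_mem hd, ?_⟩
  rw [Nat.frequently_atTop_iff_infinite] at h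
  refine (h.image (add_left_injective 1).injOn).mono ?_
  rintro _ ⟨n, hn, rfl⟩
  refine ⟨by simp, le_trans hn ?_⟩
  have hdig (i : Fin m) : digit (n + 1 + i) (lurothSum d) = d (n + i) := by
    rw [show n + 1 + (i : ℕ) = n + i + 1 by ring, digit_succ_lurothSum hd]
  simp only [hdig]
  rw [← Finset.mul_prod_erase _ _ (Finset.mem_univ (⟨0, hm⟩ : Fin m))]
  refine le_mul_of_one_le_right (by positivity) ?_
  refine Finset.prod_induction _ (fun y : ℝ => 1 ≤ y) (fun a b ha hb => one_le_mul_of_one_le_of_one_le ha hb)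
    le_rfl fun i _ => ?_
  refine Real.one_le_rpow ?_ (ht i).le
  exact_mod_cast (by linarith [hd (n + i)] : 1 ≤ d (n + i))

/-! ### Dimension of images under maps with Hölder inverse -/

/-- The hypothesis makes `g` injective on `S` with an `s`-Hölder inverse, and an `s`-Hölder map
multiplies dimension by at most `1 / s`. -/
lemma mul_dimH_le_dimH_image {S : Set ℝ} {g : ℝ → ℝ} {C s : ℝ} (hC : 0 ≤ C) (hs : 0 < s)
    (h : ∀ x ∈ S, ∀ y ∈ S, |x - y| ≤ C * |g x - g y| ^ s) :
    ENNReal.ofReal s * dimH S ≤ dimH (g '' S) := by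
  have hinj : Set.InjOn g S := fun x hx y hy hxy => by
    have := h x hx y hy
    rw [hxy, sub_self, abs_zero, Real.zero_rpow hs.ne', mul_zero] at this
    exact sub_eq_zero.1 (abs_nonpos_iff.1 this)
  have hinv := hinj.leftInvOn_invFunOn
  lift s to NNReal using hs.le
  lift C to NNReal using hC
  have hs' : 0 < s := by exact_mod_cast hs
  have hH : HolderOnWith C s (Function.invFunOn g S) (g '' S) := by
    rintro _ ⟨x, hx, rfl⟩ _ ⟨y, hy, rfl⟩
    rw [hinv hx, hinv hy, edist_dist, edist_dist, Real.dist_eq, Real.dist_eq,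
      ENNReal.ofReal_rpow_of_nonneg (abs_nonneg _) s.coe_nonneg, ← ENNReal.ofReal_coe_nnreal,
      ← ENNReal.ofReal_mul C.coe_nonneg]
    exact ENNReal.ofReal_le_ofReal (h x hx y hy)
  have h2 := hH.dimH_image_le hs'
  rw [hinv.image_image, ENNReal.le_div_iff_mul_le (Or.inl (by exact_mod_cast hs'.ne'))
    (Or.inl ENNReal.coe_ne_top)] at h2
  rwa [ENNReal.ofReal_coe_nnreal, mul_comm]

/-- A lower bound for the dimension of a set of Lüroth series. The digits `e x n` are read off
along an orbit `z x n` with contraction rates `ρ`; points with different current digit are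
separated in the Lüroth system up to the factor `M n`. -/
theorem mul_dimH_le_dimH_image_lurothSum {S : Set ℝ} {z : ℝ → ℕ → ℝ} {e : ℝ → ℕ → ℕ}
    {ρ : ℕ → ℕ → ℝ} {M : ℕ → ℝ} {s C : ℝ} (hs : 0 < s) (hs1 : s ≤ 1)
    (he : ∀ x ∈ S, ∀ n, 2 ≤ e x n) (hz0 : ∀ x ∈ S, z x 0 = x)
    (hz : ∀ x ∈ S, ∀ n, z x n ∈ Set.Icc (0 : ℝ) 1) (hρ : ∀ n k, 2 ≤ k → 0 ≤ ρ n k)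
    (hM : ∀ n, 1 ≤ M n)
    (hcontr : ∀ x ∈ S, ∀ y ∈ S, ∀ n, e x n = e y n →
      |z x n - z y n| ≤ ρ n (e x n) * |z x (n + 1) - z y (n + 1)|)
    (hsep : ∀ x ∈ S, ∀ y ∈ S, ∀ n, e y n < e x n →
      |z x n - z y n| ≤
        M n * |lurothSum (fun i => e x (n + i)) - lurothSum (fun i => e y (n + i))|)
    (hC : ∀ x ∈ S, ∀ n, (∏ i ∈ Finset.range n, ρ i (e x i)) * M n ^ s ≤
      C * (∏ i ∈ Finset.range n, ((e x i : ℝ) * (e x i - 1))⁻¹) ^ s) :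
    ENNReal.ofReal s * dimH S ≤ dimH ((fun x => lurothSum (e x)) '' S) := by
  rcases S.eq_empty_or_nonempty with rfl | ⟨x₀, hx₀⟩
  · simp
  have hC0 : 0 ≤ C := by
    have h := hC x₀ hx₀ 0
    simp only [Finset.range_zero, Finset.prod_empty, one_mul, Real.one_rpow, mul_one] at h
    exact le_trans (Real.rpow_nonneg (by linarith [hM 0]) _) h
  have hprod (x) (hx : x ∈ S) (n) : 0 ≤ ∏ i ∈ Finset.range n, ρ i (e x i) :=
    Finset.prod_nonneg fun i _ => hρ i _ (he x hx i)
  have hdist : ∀ x ∈ S, ∀ y ∈ S, ∀ n, (∀ i < n, e x i = e y i) →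
      |x - y| ≤ (∏ i ∈ Finset.range n, ρ i (e x i)) * |z x n - z y n| := by
    intro x hx y hy n
    induction n with
    | zero => intro _; simp [hz0 x hx, hz0 y hy]
    | succ n ih =>
      intro h
      refine (ih fun i hi => h i (by omega)).trans ?_
      rw [Finset.prod_range_succ, mul_assoc]
      exact mul_le_mul_of_nonneg_left (hcontr x hx y hy n (h n (by omega))) (hprod x hx n)
  have hle1 (x) (hx : x ∈ S) (y) (hy : y ∈ S) (n) : |z x n - z y n| ≤ 1 := by
    have h1 := hz x hx n
    have h2 := hz y hy n
    rw [abs_le]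
    constructor <;> linarith [h1.1, h1.2, h2.1, h2.2]
  have hsep' : ∀ x ∈ S, ∀ y ∈ S, ∀ n, e x n ≠ e y n → |z x n - z y n| ≤
        M n * |lurothSum (fun i => e x (n + i)) - lurothSum (fun i => e y (n + i))| := by
    intro x hx y hy n hne
    rcases lt_or_gt_of_ne hne with h | h
    · rw [abs_sub_comm, abs_sub_comm (lurothSum _)]
      exact hsep y hy x hx n h
    · exact hsep x hx y hy n h
  refine mul_dimH_le_dimH_image hC0 hs fun x hx y hy => ?_
  by_cases hall : ∀ n, e x n = e y n
  -- If all digits agree, the mass bound gives `|x - y| ≤ C * 2 ^ (-s * n)` for every `n`, hence `x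
  -- = y`.
  · have hlim : Tendsto (fun n : ℕ => C * ((1 / 2 : ℝ) ^ s) ^ n) atTop (nhds (C * 0)) :=
      (tendsto_pow_atTop_nhds_zero_of_lt_one (by positivity)
        (Real.rpow_lt_one (by norm_num) (by norm_num) hs)).const_mul C
    have hle : |x - y| ≤ C * 0 := by
      refine ge_of_tendsto' hlim fun n => ?_
      calc |x - y| ≤ (∏ i ∈ Finset.range n, ρ i (e x i)) * 1 :=
            (hdist x hx y hy n fun i _ => hall i).trans
              (mul_le_mul_of_nonneg_left (hle1 x hx y hy n) (hprod x hx n))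
        _ ≤ (∏ i ∈ Finset.range n, ρ i (e x i)) * M n ^ s :=
            mul_le_mul_of_nonneg_left (Real.one_le_rpow (hM n) hs.le) (hprod x hx n)
        _ ≤ _ := hC x hx n
        _ ≤ C * ((1 / 2 : ℝ) ^ n) ^ s := by
            gcongr
            · exact (prod_inv_mul_pred_pos (he x hx) n).le
            · exact prod_inv_mul_pred_le (he x hx) n
        _ = _ := by
            rw [← Real.rpow_natCast, ← Real.rpow_natCast, ← Real.rpow_mul (by norm_num),
              ← Real.rpow_mul (by norm_num), mul_comm s]
    rw [mul_zero] at hle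
    exact hle.trans (by positivity)
  · push Not at hall
    classical
    -- At the first differing digit, the common prefix contributes the mass factor for `x, y` and
    -- the cylinder length for the series. `hC` compares the two.
    set n := Nat.find hall with hn
    have hne : e x n ≠ e y n := Nat.find_spec hall
    have heq : ∀ i < n, e x i = e y i := fun i hi => not_not.1 (Nat.find_min hall hi)
    set u := |lurothSum (fun i => e x (n + i)) - lurothSum (fun i => e y (n + i))|
    have hM0 : 0 ≤ M n := by linarith [hM n]
    have hz1 : |z x n - z y n| ≤ (M n * u) ^ s := by
      calc |z x n - z y n| = |z x n - z y n| ^ (1 : ℝ) := (Real.rpow_one _).symm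
        _ ≤ |z x n - z y n| ^ s :=
            Real.rpow_le_rpow_of_exponent_ge' (abs_nonneg _) (hle1 x hx y hy n) hs.le hs1
        _ ≤ _ := Real.rpow_le_rpow (abs_nonneg _) (hsep' x hx y hy n hne) hs.le
    have hQ := (prod_inv_mul_pred_pos (he x hx) n).le
    calc |x - y| ≤ _ := hdist x hx y hy n heq
      _ ≤ (∏ i ∈ Finset.range n, ρ i (e x i)) * (M n * u) ^ s :=
          mul_le_mul_of_nonneg_left hz1 (hprod x hx n)
      _ = (∏ i ∈ Finset.range n, ρ i (e x i)) * M n ^ s * u ^ s := by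
          rw [Real.mul_rpow hM0 (abs_nonneg _), mul_assoc]
      _ ≤ C * (∏ i ∈ Finset.range n, ((e x i : ℝ) * (e x i - 1))⁻¹) ^ s * u ^ s :=
          mul_le_mul_of_nonneg_right (hC x hx n) (Real.rpow_nonneg (abs_nonneg _) _)
      _ = C * |lurothSum (e x) - lurothSum (e y)| ^ s := by
          rw [lurothSum_sub_lurothSum (he x hx) (he y hy) heq, abs_mul, abs_of_nonneg hQ,
            Real.mul_rpow hQ (abs_nonneg _), mul_assoc]

/-! ### Series with all digits free in doubly exponentially growing ranges -/

lemma lurothSum_shift_eq {d : ℕ → ℕ} (hd : ∀ i, 2 ≤ d i) (n : ℕ) :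
    lurothSum (fun i => d (n + i)) = (d n : ℝ)⁻¹ +
      ((d n : ℝ) * (d n - 1))⁻¹ * lurothSum (fun i => d (n + 1 + i)) := by
  rw [lurothSum_eq (d := fun i => d (n + i)) fun i => hd _]
  have : (fun i => d (n + (i + 1))) = fun i => d (n + 1 + i) := by
    ext i; congr 1; ring
  rw [this, add_zero]

/-- The orbit of `x` under the mixed radix expansion with bases `K 0, K 1, …`. -/
def radixOrbit (K : ℕ → ℕ) (x : ℝ) : ℕ → ℝ
  | 0 => x
  | n + 1 => K n * radixOrbit K x n - ⌊K n * radixOrbit K x n⌋₊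

/-- The mixed radix digits, shifted so that the `n`-th one lies in `[K n, 2 * K n)`. -/
def radixDigit (K : ℕ → ℕ) (x : ℝ) (n : ℕ) : ℕ := K n + ⌊K n * radixOrbit K x n⌋₊

lemma radixOrbit_mem {K : ℕ → ℕ} {x : ℝ} (hx : x ∈ Set.Ico (0 : ℝ) 1) (n : ℕ) :
    radixOrbit K x n ∈ Set.Ico (0 : ℝ) 1 := by
  induction n with
  | zero => exact hx
  | succ n ih =>
    have h0 : 0 ≤ (K n : ℝ) * radixOrbit K x n := mul_nonneg (by positivity) ih.1
    have h1 := Nat.floor_le h0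
    have h2 := Nat.lt_floor_add_one ((K n : ℝ) * radixOrbit K x n)
    rw [radixOrbit]
    constructor <;> linarith

lemma radixDigit_add_radixOrbit {K : ℕ → ℕ} (x : ℝ) (n : ℕ) :
    (K n : ℝ) * radixOrbit K x n = radixDigit K x n - K n + radixOrbit K x (n + 1) := by
  rw [radixDigit, radixOrbit]
  push_cast
  ring

lemma radixDigit_lt {K : ℕ → ℕ} {x : ℝ} (hx : x ∈ Set.Ico (0 : ℝ) 1) {n : ℕ}
    (hK : 0 < K n) : radixDigit K x n < 2 * K n := by
  have h := radixOrbit_mem (K := K) hx n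
  have hK' : (0 : ℝ) < K n := by exact_mod_cast hK
  have : ⌊(K n : ℝ) * radixOrbit K x n⌋₊ < K n := by
    rw [Nat.floor_lt (mul_nonneg hK'.le h.1)]
    nlinarith [h.2]
  unfold radixDigit
  omega

/-- Mixed radix cells are spaced by about `1 / K n` and the Lüroth cylinders with digits in `[K n, 2
* K n)` by about `1 / K n ^ 2`; their quotient is the separation factor `16 * K n`. -/
theorem le_dimH_image_radixDigit {K : ℕ → ℕ} (hK : ∀ n, 3 ≤ K n) {s C : ℝ} (hs : 0 < s)
    (hs1 : s ≤ 1)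
    (hC : ∀ n, (∏ i ∈ Finset.range n, (K i : ℝ)⁻¹) * (16 * K n : ℝ) ^ s ≤
      C * (∏ i ∈ Finset.range n, (4 * (K i : ℝ) ^ 2)⁻¹) ^ s) :
    ENNReal.ofReal s ≤
      dimH ((fun x => lurothSum (radixDigit K x)) '' Set.Ico (0 : ℝ) 1) := by
  have hK' (n) : (3 : ℝ) ≤ K n := by exact_mod_cast hK n
  have hge (x n) : K n ≤ radixDigit K x n := by unfold radixDigit; omega
  have hd (x n) : 2 ≤ radixDigit K x n := le_trans (by linarith [hK n]) (hge x n)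
  have hC0 : 0 ≤ C := by
    have h := hC 0
    simp only [Finset.range_zero, Finset.prod_empty, one_mul, Real.one_rpow, mul_one] at h
    exact le_trans (by positivity) h
  have hdim : dimH (Set.Ico (0 : ℝ) 1) = 1 := by
    rw [Real.dimH_of_nonempty_interior (by simp)]
    simp
  have := mul_dimH_le_dimH_image_lurothSum (S := Set.Ico (0 : ℝ) 1) (z := radixOrbit K)
    (e := radixDigit K) (ρ := fun n _ => (K n : ℝ)⁻¹) (M := fun n => 16 * K n) (C := C) hs hs1
    (fun x _ n => hd x n) (fun x _ => rfl)
    (fun x hx n => Set.Ico_subset_Icc_self (radixOrbit_mem hx n))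
    (fun n _ _ => by positivity) (fun n => by linarith [hK' n]) ?_ ?_ ?_
  · rwa [hdim, mul_one] at this
  · intro x _ y _ n hxy
    have h1 := radixDigit_add_radixOrbit (K := K) x n
    have h2 := radixDigit_add_radixOrbit (K := K) y n
    rw [hxy] at h1
    have hKn : (0 : ℝ) < K n := by linarith [hK' n]
    rw [show radixOrbit K x (n + 1) - radixOrbit K y (n + 1) =
      K n * (radixOrbit K x n - radixOrbit K y n) by linarith, abs_mul, abs_of_pos hKn,
      inv_mul_cancel_left₀ hKn.ne']
  · intro x hx y hy n hlt
    have hKn : (0 : ℝ) < K n := by linarith [hK' n]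
    have h1 := radixDigit_add_radixOrbit (K := K) x n
    have h2 := radixDigit_add_radixOrbit (K := K) y n
    have hx1 := radixOrbit_mem (K := K) hx (n + 1)
    have hy1 := radixOrbit_mem (K := K) hy (n + 1)
    rw [lurothSum_shift_eq (hd x), lurothSum_shift_eq (hd y)]
    -- Digits at least 3 keep the tail below 1/2, which leaves a gap even between neighbouring
    -- cylinders.
    have hX0 : lurothSum (fun i => radixDigit K x (n + 1 + i)) ≤ 1 / 2 := by
      refine (lurothSum_le_inv_pred fun i => hd _ _).trans ?_
      rw [one_div]
      apply inv_anti₀ (by norm_num)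
      have : (K (n + 1) : ℝ) ≤ radixDigit K x (n + 1 + 0) := by exact_mod_cast hge x (n + 1)
      linarith [hK' (n + 1)]
    have hY0 := lurothSum_nonneg (d := fun i => radixDigit K y (n + 1 + i)) fun i => hd _ _
    set X := lurothSum (fun i => radixDigit K x (n + 1 + i))
    set Y := lurothSum (fun i => radixDigit K y (n + 1 + i))
    have hb : (radixDigit K x n : ℝ) ≤ 2 * K n := by
      exact_mod_cast (radixDigit_lt hx (by linarith [hK n])).le
    have hlt' : (radixDigit K y n : ℝ) + 1 ≤ radixDigit K x n := by exact_mod_cast hlt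
    have ha : (K n : ℝ) ≤ radixDigit K y n := by exact_mod_cast hge y n
    set a : ℝ := (radixDigit K y n : ℝ)
    set b : ℝ := (radixDigit K x n : ℝ)
    have ha3 : 3 ≤ a := (hK' n).trans ha
    have hb1 : 0 < b - 1 := by linarith
    have ha0 : 0 < a := by linarith
    have hb0 : 0 < b := by linarith
    -- The tail of the series with digit `b` uses up at most half of `a⁻¹ - b⁻¹ = (b - a) / (a *
    -- b)`; the other half remains, and `a * b ≤ 4 * K n ^ 2`.
    have hlow : (b - a) / (8 * (K n : ℝ) ^ 2) ≤
        (a⁻¹ + (a * (a - 1))⁻¹ * Y) - (b⁻¹ + (b * (b - 1))⁻¹ * X) := by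
      have e1 : 0 ≤ (a * (a - 1))⁻¹ * Y :=
        mul_nonneg (inv_nonneg.2 (mul_nonneg (by linarith) (by linarith))) hY0
      have e2 : (b * (b - 1))⁻¹ * X ≤ (b - a) / (2 * (a * b)) := by
        calc (b * (b - 1))⁻¹ * X ≤ (b * (b - 1))⁻¹ * (1 / 2) :=
              mul_le_mul_of_nonneg_left hX0 (by positivity)
          _ ≤ (a * b)⁻¹ * (1 / 2) := by
              gcongr ?_ * _
              apply inv_anti₀ (by positivity)
              nlinarith
          _ = 1 / (2 * (a * b)) := by
              rw [mul_inv, mul_comm a b]; field_simp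
          _ ≤ _ := by
              gcongr
              linarith
      have e3 : a⁻¹ - b⁻¹ = 2 * ((b - a) / (2 * (a * b))) := by
        rw [inv_sub_inv ha0.ne' hb0.ne']
        field_simp
      have e4 : (b - a) / (8 * (K n : ℝ) ^ 2) ≤ (b - a) / (2 * (a * b)) := by
        apply div_le_div_of_nonneg_left (by linarith) (by positivity)
        nlinarith
      linarith
    have hup : |radixOrbit K x n - radixOrbit K y n| ≤ 2 * (b - a) / K n := by
      rw [le_div_iff₀ hKn]
      rw [← abs_of_pos hKn]
      rw [← abs_mul, abs_le]
      constructor <;> linarith [hx1.1, hx1.2, hy1.1, hy1.2]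
    calc _ ≤ _ := hup
      _ = 16 * K n * ((b - a) / (8 * (K n : ℝ) ^ 2)) := by field_simp; ring
      _ ≤ _ := by
          rw [abs_sub_comm]
          exact mul_le_mul_of_nonneg_left (hlow.trans (le_abs_self _)) (by positivity)
  · intro x hx n
    refine (hC n).trans ?_
    refine mul_le_mul_of_nonneg_left (Real.rpow_le_rpow ?_ ?_ hs.le) hC0
    · exact Finset.prod_nonneg fun i _ => by positivity
    · refine Finset.prod_le_prod (fun i _ => by positivity) fun i _ => ?_
      have h1 : (2 : ℝ) ≤ radixDigit K x i := by exact_mod_cast hd x i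
      have h2 : (radixDigit K x i : ℝ) ≤ 2 * K i := by
        exact_mod_cast (radixDigit_lt hx (by linarith [hK i])).le
      apply inv_anti₀ (mul_pos (by linarith) (by linarith))
      nlinarith

lemma exists_natCast_le_mul_pow_add {c γ : ℝ} (hc : 1 < c) (hγ : 0 < γ) :
    ∃ N : ℝ, 0 ≤ N ∧ ∀ n : ℕ, (n : ℝ) ≤ γ * c ^ n + N := by
  have h := (isLittleO_coe_const_pow_of_one_lt (R := ℝ) hc).def hγ
  obtain ⟨N, hN⟩ := eventually_atTop.1 h
  refine ⟨N, by positivity, fun n => ?_⟩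
  rcases le_total N n with hn | hn
  · have := hN n hn
    rw [Real.norm_of_nonneg (by positivity), Real.norm_of_nonneg (by positivity)] at this
    linarith [(Nat.cast_nonneg N : (0 : ℝ) ≤ N)]
  · have h1 : (n : ℝ) ≤ N := by exact_mod_cast hn
    have : 0 ≤ γ * c ^ n := by positivity
    linarith

/-- The mass condition for digits of size about `exp (l * c ^ n)`. -/
lemma exists_radix_mass_bound {c l s : ℝ} (hc : 1 < c) (hl : 0 < l) (hs : 0 < s)
    (hsc : s * (c + 1) < 1) {K : ℕ → ℕ} (hK : ∀ n, Real.exp (l * c ^ n) ≤ K n)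
    (hK4 : ∀ n, (K n : ℝ) ≤ 4 * Real.exp (l * c ^ n)) :
    ∃ C : ℝ, ∀ n, (∏ i ∈ Finset.range n, (K i : ℝ)⁻¹) * (16 * K n : ℝ) ^ s ≤
      C * (∏ i ∈ Finset.range n, (4 * (K i : ℝ) ^ 2)⁻¹) ^ s := by
  -- `γ * c ^ n` is the surplus in the logarithmic comparison; it is positive because `s * (c + 1) <
  -- 1`, and it absorbs the factor `4 ^ (s * n)`.
  set γ := l * (1 - s * (c + 1)) / (c - 1) with hγ
  have hc1 : 0 < c - 1 := by linarith
  have hγ0 : 0 < γ := div_pos (mul_pos hl (by linarith)) hc1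
  have hlog4 : 0 < Real.log 4 := Real.log_pos (by norm_num)
  obtain ⟨N, hN0, hN⟩ := exists_natCast_le_mul_pow_add hc
    (γ := γ / (s * Real.log 4)) (div_pos hγ0 (mul_pos hs hlog4))
  have hK0 (n) : (0 : ℝ) < K n := (Real.exp_pos _).trans_le (hK n)
  have h2s : 0 < 1 - 2 * s := by nlinarith
  refine ⟨Real.exp (s * (Real.log 16 + Real.log 4) + s * Real.log 4 * N +
    (1 - 2 * s) * l / (c - 1)), fun n => ?_⟩
  set L : ℕ → ℝ := fun i => Real.log (K i) with hL
  have hKL (i) : (K i : ℝ) = Real.exp (L i) := (Real.exp_log (hK0 i)).symm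
  have hLlow (i) : l * c ^ i ≤ L i := by
    rw [hL, Real.le_log_iff_exp_le (hK0 i)]; exact hK i
  have hLup (i) : L i ≤ Real.log 4 + l * c ^ i := by
    rw [hL, Real.log_le_iff_le_exp (hK0 i), Real.exp_add, Real.exp_log (by norm_num)]
    exact hK4 i
  have hsum : l * ((c ^ n - 1) / (c - 1)) ≤ ∑ i ∈ Finset.range n, L i := by
    rw [← geom_sum_eq hc.ne', Finset.mul_sum]
    exact Finset.sum_le_sum fun i _ => hLlow i
  have e1 : ∏ i ∈ Finset.range n, (K i : ℝ)⁻¹ = Real.exp (-∑ i ∈ Finset.range n, L i) := by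
    rw [← Finset.sum_neg_distrib, Real.exp_sum]
    exact Finset.prod_congr rfl fun i _ => by rw [hKL, Real.exp_neg]
  have e2 : ∏ i ∈ Finset.range n, (4 * (K i : ℝ) ^ 2)⁻¹ =
      Real.exp (-(n * Real.log 4 + 2 * ∑ i ∈ Finset.range n, L i)) := by
    have : (n * Real.log 4 + 2 * ∑ i ∈ Finset.range n, L i) =
        ∑ i ∈ Finset.range n, (Real.log 4 + 2 * L i) := by
      rw [Finset.sum_add_distrib, Finset.mul_sum]; simp
    rw [this, ← Finset.sum_neg_distrib, Real.exp_sum]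
    refine Finset.prod_congr rfl fun i _ => ?_
    rw [Real.exp_neg, Real.exp_add, Real.exp_log (by norm_num), two_mul, Real.exp_add, ← hKL, sq]
  have e3 : (16 * K n : ℝ) ^ s = Real.exp (s * (Real.log 16 + L n)) := by
    rw [Real.rpow_def_of_pos (by have := hK0 n; positivity),
      Real.log_mul (by norm_num) (hK0 n).ne', mul_comm]
  rw [e1, e2, e3, ← Real.exp_mul, ← Real.exp_add, ← Real.exp_add, Real.exp_le_exp]
  have hn : s * Real.log 4 * n ≤ γ * c ^ n + s * Real.log 4 * N := by
    have := mul_le_mul_of_nonneg_left (hN n) (mul_pos hs hlog4).le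
    have e : s * Real.log 4 * (γ / (s * Real.log 4) * c ^ n + N) =
        γ * c ^ n + s * Real.log 4 * N := by field_simp
    linarith
  have hγc : γ * c ^ n =
      (1 - 2 * s) * (l * ((c ^ n - 1) / (c - 1))) + (1 - 2 * s) * l / (c - 1) -
        s * (l * c ^ n) := by
    rw [hγ]; field_simp; ring
  have h1 := mul_le_mul_of_nonneg_left hsum h2s.le
  have h2 := mul_le_mul_of_nonneg_left (hLup n) hs.le
  linarith

/-- Lower bound for the dimension if `Ψ n ≤ exp (c ^ n)` infinitely often. -/
theorem ofReal_le_dimH_limsupSet {m : ℕ} (hm : 1 ≤ m) {t : Fin m → ℝ} (ht : ∀ i, 0 < t i)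
    {Ψ : ℕ → ℝ} {c s : ℝ} (hc : 1 < c) (hs : 0 < s) (hsc : s * (c + 1) < 1)
    (h : ∃ᶠ n in atTop, Ψ n ≤ Real.exp (c ^ n)) :
    ENNReal.ofReal s ≤ dimH (limsupSet t Ψ) := by
  have ht0 := ht ⟨0, hm⟩
  -- Index `n` of the series is the Lüroth digit `n + 1`, so the requirement is `t₀ * l * c ^ n = c
  -- ^ (n + 1)`.
  set l := c / t ⟨0, hm⟩ with hl
  have hl0 : 0 < l := by positivity
  set K : ℕ → ℕ := fun n => ⌈Real.exp (l * c ^ n)⌉₊ + 2 with hKdef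
  have hpos (n : ℕ) : 0 < l * c ^ n := by positivity
  have hK (n) : Real.exp (l * c ^ n) ≤ K n := by
    have := Nat.le_ceil (Real.exp (l * c ^ n))
    rw [hKdef]; push_cast; linarith
  have hK4 (n) : (K n : ℝ) ≤ 4 * Real.exp (l * c ^ n) := by
    have h1 := Nat.ceil_lt_add_one (Real.exp_pos (l * c ^ n)).le
    have h2 := Real.one_le_exp (hpos n).le
    rw [hKdef]; push_cast; linarith
  have hK3 (n) : 3 ≤ K n := by
    have := Nat.ceil_pos.2 (Real.exp_pos (l * c ^ n))
    simp only [hKdef]; omega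
  obtain ⟨C, hC⟩ := exists_radix_mass_bound hc hl0 hs hsc hK hK4
  refine (le_dimH_image_radixDigit hK3 hs (by nlinarith) hC).trans (dimH_mono ?_)
  rintro _ ⟨x, -, rfl⟩
  have hge (n) : K n ≤ radixDigit K x n := by unfold radixDigit; omega
  refine lurothSum_mem_limsupSet hm ht (fun n => le_trans (by linarith [hK3 n]) (hge n)) ?_
  rw [← map_add_atTop_eq_nat 1, frequently_map] at h
  refine h.mono fun n hn => hn.trans ?_
  calc Real.exp (c ^ (n + 1)) = Real.exp (l * c ^ n) ^ t ⟨0, hm⟩ := by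
        rw [← Real.exp_mul, hl]; congr 1; field_simp; ring
    _ ≤ _ := by
        refine Real.rpow_le_rpow (Real.exp_pos _).le ((hK n).trans ?_) ht0.le
        exact_mod_cast hge n

/-! ### Inserting prescribed digits into a Lüroth expansion -/

/-- The orbit of `x` under the Lüroth map, waiting at the times in `P`. -/
def insertOrbit (P : ℕ → Prop) [DecidablePred P] (x : ℝ) : ℕ → ℝ
  | 0 => x
  | n + 1 => if P n then insertOrbit P x n else lurothMap (insertOrbit P x n)

/-- The Lüroth digits of `x`, with the digits `D n` inserted at the positions in `P`. -/
def insertDigit (P : ℕ → Prop) [DecidablePred P] (D : ℕ → ℕ) (x : ℝ) (n : ℕ) : ℕ :=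
  if P n then D n else firstDigit (insertOrbit P x n)

section Insert

variable {P : ℕ → Prop} [DecidablePred P] {D : ℕ → ℕ}

lemma insertOrbit_mem {x : ℝ} (hx : x ∈ Set.Ioc (0 : ℝ) 1) (n : ℕ) :
    insertOrbit P x n ∈ Set.Ioc (0 : ℝ) 1 := by
  induction n with
  | zero => exact hx
  | succ n ih =>
    rw [insertOrbit]
    split_ifs
    · exact ih
    · exact lurothMap_mem ih

lemma two_le_insertDigit (hD : ∀ n, 3 ≤ D n) {x : ℝ} (hx : x ∈ Set.Ioc (0 : ℝ) 1) (n : ℕ) :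
    2 ≤ insertDigit P D x n := by
  unfold insertDigit
  split_ifs
  · linarith [hD n]
  · exact two_le_firstDigit (insertOrbit_mem hx n)

lemma insertOrbit_eq {x : ℝ} (hx : x ∈ Set.Ioc (0 : ℝ) 1) {n : ℕ} (hn : ¬ P n) :
    insertOrbit P x n = (insertDigit P D x n : ℝ)⁻¹ +
      ((insertDigit P D x n : ℝ) * (insertDigit P D x n - 1))⁻¹ * insertOrbit P x (n + 1) := by
  rw [insertOrbit, insertDigit, if_neg hn, if_neg hn]
  exact eq_firstDigit_add_lurothMap (insertOrbit_mem hx n)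

/-- A digit 2 is never an inserted one, and it halves the distance to 1 on both sides. At the first
digit at least 3 the series is at most 1/2, so the right side is at least 1. The error `(1 / 2) ^ k`
covers a run of 2s that never ends. -/
lemma one_sub_insertOrbit_le (hD : ∀ n, 3 ≤ D n) {x : ℝ} (hx : x ∈ Set.Ioc (0 : ℝ) 1) (n : ℕ) :
    1 - insertOrbit P x n ≤ 2 * (1 - lurothSum (fun i => insertDigit P D x (n + i))) := by
  have hd := two_le_insertDigit (P := P) hD hx
  have hthree (n : ℕ) (h3 : 3 ≤ insertDigit P D x n) :
      lurothSum (fun i => insertDigit P D x (n + i)) ≤ 1 / 2 := by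
    refine (lurothSum_le_inv_pred fun i => hd _).trans ?_
    rw [one_div]
    apply inv_anti₀ (by norm_num)
    have : (3 : ℝ) ≤ insertDigit P D x (n + 0) := by exact_mod_cast h3
    linarith
  have key : ∀ k n : ℕ, 1 - insertOrbit P x n ≤
      2 * (1 - lurothSum (fun i => insertDigit P D x (n + i))) + (1 / 2) ^ k := by
    intro k
    induction k with
    | zero =>
      intro n
      have := lurothSum_le_one (d := fun i => insertDigit P D x (n + i)) fun i => hd _
      have := (insertOrbit_mem (P := P) hx n).1
      simp only [pow_zero]
      linarith
    | succ k ih =>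
      intro n
      by_cases h3 : 3 ≤ insertDigit P D x n
      · have := hthree n h3
        have := (insertOrbit_mem (P := P) hx n).1
        have : (0 : ℝ) < (1 / 2) ^ (k + 1) := by positivity
        linarith
      · have h2 : insertDigit P D x n = 2 := by have := hd n; omega
        have hP : ¬ P n := fun hP => by
          rw [insertDigit, if_pos hP] at h3
          exact h3 (hD n)
        rw [lurothSum_shift_eq hd, insertOrbit_eq (D := D) hx hP, h2, pow_succ]
        have := ih (n + 1)
        norm_num
        linarith
  have hlim : Tendsto (fun k : ℕ =>
      2 * (1 - lurothSum (fun i => insertDigit P D x (n + i))) + (1 / 2 : ℝ) ^ k) atTop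
      (nhds (2 * (1 - lurothSum (fun i => insertDigit P D x (n + i))) + 0)) :=
    (tendsto_pow_atTop_nhds_zero_of_lt_one (by norm_num) (by norm_num)).const_add _
  rw [add_zero] at hlim
  exact ge_of_tendsto' hlim fun k => key k n

lemma insertOrbit_le (hD : ∀ n, 3 ≤ D n) {x : ℝ} (hx : x ∈ Set.Ioc (0 : ℝ) 1) (n : ℕ) :
    insertOrbit P x n ≤ (if P n then 2 * (D n : ℝ) else 2) *
      lurothSum (fun i => insertDigit P D x (n + i)) := by
  have hd := two_le_insertDigit (P := P) hD hx
  have h1 : (insertDigit P D x n : ℝ)⁻¹ ≤ lurothSum (fun i => insertDigit P D x (n + i)) :=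
    inv_le_lurothSum (d := fun i => insertDigit P D x (n + i)) fun i => hd _
  have h2 := insertOrbit_mem (P := P) hx n
  split_ifs with hP
  · rw [insertDigit, if_pos hP] at h1
    have hDn : (3 : ℝ) ≤ D n := by exact_mod_cast hD n
    rw [inv_le_iff_one_le_mul₀ (by linarith)] at h1
    have : lurothSum (fun i => insertDigit P D x (n + i)) * D n =
      D n * lurothSum (fun i => insertDigit P D x (n + i)) := mul_comm _ _
    linarith [h2.2]
  · refine le_trans ?_ (mul_le_mul_of_nonneg_left h1 (by norm_num))
    have h3 := le_inv_firstDigit_pred h2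
    have h4 : (2 : ℝ) ≤ insertDigit P D x n := by exact_mod_cast hd n
    rw [insertDigit, if_neg hP] at h4 ⊢
    refine h3.trans ?_
    rw [← div_eq_mul_inv, inv_eq_one_div, div_le_div_iff₀ (by linarith) (by linarith)]
    linarith

/-- An inserted digit shrinks the cylinder of the series but leaves the original point where it is.
Every free digit has `q ≤ 1/2`, hence saves `(1 - s) * log 2` when `q` is compared with `q ^ s`. The
weights `w` are the costs of the insertions, which these savings must cover. -/
theorem le_dimH_image_insertDigit (hD : ∀ n, 3 ≤ D n) {s : ℝ} (hs : 0 < s) (hs1 : s ≤ 1)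
    {w : ℕ → ℝ} (hw0 : ∀ i, 0 ≤ w i) (hw : ∀ i, P i → 2 * Real.log (D i) + Real.log 2 ≤ w i)
    (hsum : ∀ n : ℕ, ∑ i ∈ Finset.range n, w i ≤ (1 - s) * Real.log 2 * n) :
    ENNReal.ofReal s ≤
      dimH ((fun x => lurothSum (insertDigit P D x)) '' Set.Ioc (0 : ℝ) 1) := by
  have hdim : dimH (Set.Ioc (0 : ℝ) 1) = 1 := by
    rw [Real.dimH_of_nonempty_interior (by simp)]
    simp
  have hD' (n) : (3 : ℝ) ≤ D n := by exact_mod_cast hD n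
  have hlog2 : 0 < Real.log 2 := Real.log_pos (by norm_num)
  -- When the digits at `n` differ, the tails start at `n + 1`, and an inserted digit there can pull
  -- the point of the series towards the end of its cylinder.
  set M : ℕ → ℝ := fun n => if P (n + 1) then 2 * (D (n + 1) : ℝ) else 2 with hMdef
  have hM2 (n) : 2 ≤ M n := by
    simp only [hMdef]
    split_ifs
    · linarith [hD' (n + 1)]
    · rfl
  have := mul_dimH_le_dimH_image_lurothSum (S := Set.Ioc (0 : ℝ) 1) (z := insertOrbit P)
    (e := insertDigit P D) (ρ := fun n k => if P n then 1 else ((k : ℝ) * (k - 1))⁻¹)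
    (M := M) (C := 2 * Real.exp (2 * ((1 - s) * Real.log 2))) hs hs1
    (fun x hx n => two_le_insertDigit hD hx n) (fun x _ => rfl)
    (fun x hx n => Set.Ioc_subset_Icc_self (insertOrbit_mem hx n)) ?_
    (fun n => by linarith [hM2 n]) ?_ ?_ ?_
  · rwa [hdim, mul_one] at this
  · intro n k hk
    split_ifs
    · exact zero_le_one
    · exact (inv_mul_pred_pos hk).le
  · intro x hx y hy n hxy
    split_ifs with hP
    · simp [insertOrbit, hP]
    · rw [insertOrbit_eq (D := D) hx hP, insertOrbit_eq (D := D) hy hP, ← hxy,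
        add_sub_add_left_eq_sub, ← mul_sub, abs_mul,
        abs_of_pos (inv_mul_pred_pos (two_le_insertDigit hD hx n))]
  · intro x hx y hy n hlt
    have hP : ¬ P n := fun hP => by
      rw [insertDigit, insertDigit, if_pos hP, if_pos hP] at hlt
      exact lt_irrefl _ hlt
    have hdx := two_le_insertDigit (P := P) hD hx
    have hdy := two_le_insertDigit (P := P) hD hy
    have h1 := one_sub_insertOrbit_le (P := P) hD hx (n + 1)
    have h2 := insertOrbit_le (P := P) hD hy (n + 1)
    have hX1 := lurothSum_le_one (d := fun i => insertDigit P D x (n + 1 + i)) fun i => hdx _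
    rw [lurothSum_shift_eq hdx, lurothSum_shift_eq hdy, insertOrbit_eq (D := D) hx hP,
      insertOrbit_eq (D := D) hy hP]
    set X := lurothSum (fun i => insertDigit P D x (n + 1 + i))
    set Y := lurothSum (fun i => insertDigit P D y (n + 1 + i))
    have hx1 := (insertOrbit_mem (P := P) hx (n + 1)).2
    have hy0 := (insertOrbit_mem (P := P) hy (n + 1)).1.le
    set x' := insertOrbit P x (n + 1)
    set y' := insertOrbit P y (n + 1)
    have hb2 := hdx n
    have ha2 := hdy n
    have ipb := inv_add_inv_mul_pred hb2
    have hqa := inv_mul_pred_pos ha2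
    have hqb := inv_mul_pred_pos hb2
    have hlt' : (insertDigit P D y n : ℝ) + 1 ≤ insertDigit P D x n := by exact_mod_cast hlt
    have ha2' : (2 : ℝ) ≤ insertDigit P D y n := by exact_mod_cast ha2
    set a : ℝ := (insertDigit P D y n : ℝ)
    set b : ℝ := (insertDigit P D x n : ℝ)
    -- As `a < b`, the point `y` lies above `x`. The distance splits into the height of `y` above
    -- the lower end of its cylinder, the gap between the cylinders, and the depth of `x` below the
    -- upper end of its own. `e1`, `e3`, `e2` compare these with the same parts for the series.
    have hgap : 0 ≤ a⁻¹ - (b - 1)⁻¹ := by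
      rw [sub_nonneg]
      exact inv_anti₀ (by linarith) (by linarith)
    have hMn := hM2 n
    change y' ≤ M n * Y at h2
    have e1 : (a * (a - 1))⁻¹ * y' ≤ M n * ((a * (a - 1))⁻¹ * Y) := by
      have := mul_le_mul_of_nonneg_left h2 hqa.le
      linarith
    have e2 : (b * (b - 1))⁻¹ * (1 - x') ≤ M n * ((b * (b - 1))⁻¹ * (1 - X)) := by
      have h3 : 1 - x' ≤ M n * (1 - X) :=
        h1.trans (mul_le_mul_of_nonneg_right hMn (by linarith))
      have := mul_le_mul_of_nonneg_left h3 hqb.le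
      linarith
    have e3 : a⁻¹ - (b - 1)⁻¹ ≤ M n * (a⁻¹ - (b - 1)⁻¹) :=
      le_mul_of_one_le_left hgap (by linarith)
    have e4 : 0 ≤ (a * (a - 1))⁻¹ * y' := mul_nonneg hqa.le hy0
    have e5 : 0 ≤ (b * (b - 1))⁻¹ * (1 - x') := mul_nonneg hqb.le (by linarith)
    rw [abs_sub_comm, abs_of_nonneg (by linarith), abs_sub_comm]
    refine le_trans ?_ (mul_le_mul_of_nonneg_left (le_abs_self _) (by linarith))
    rw [← ipb] at e3
    linarith
  · intro x hx n
    have hd := two_le_insertDigit (P := P) hD hx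
    set q : ℕ → ℝ := fun i => ((insertDigit P D x i : ℝ) * (insertDigit P D x i - 1))⁻¹ with hq
    have hq0 (i) : 0 < q i := inv_mul_pred_pos (hd i)
    -- At an inserted position `w i` pays for `q i ^ s ≥ q i ≥ (D i) ^ (-2)` and for the missing
    -- saving.
    have hstep (i) : (if P i then 1 else q i) ≤
        q i ^ s * Real.exp (w i - (1 - s) * Real.log 2) := by
      split_ifs with hP
      · have h1 : Real.exp (-(2 * Real.log (D i))) ≤ q i := by
          have hDi := hD' i
          rw [Real.exp_neg, two_mul, Real.exp_add, Real.exp_log (by linarith), hq]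
          simp only [insertDigit, if_pos hP]
          apply inv_anti₀ (mul_pos (by linarith) (by linarith))
          nlinarith
        have h2 : q i ≤ q i ^ s := by
          calc q i = q i ^ (1 : ℝ) := (Real.rpow_one _).symm
            _ ≤ _ := Real.rpow_le_rpow_of_exponent_ge (hq0 i)
              ((inv_mul_pred_le_half (hd i)).trans (by norm_num)) hs1
        calc (1 : ℝ) ≤ Real.exp (-(2 * Real.log (D i)) + (w i - (1 - s) * Real.log 2)) := by
              apply Real.one_le_exp
              have := hw i hP
              have : 0 < s * Real.log 2 := mul_pos hs hlog2
              linarith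
          _ ≤ _ := by
              rw [Real.exp_add]
              exact mul_le_mul_of_nonneg_right (h1.trans h2) (Real.exp_pos _).le
      · calc q i = q i ^ s * q i ^ (1 - s) := by
              rw [← Real.rpow_add (hq0 i), add_sub_cancel, Real.rpow_one]
          _ ≤ q i ^ s * (1 / 2) ^ (1 - s) := by
              refine mul_le_mul_of_nonneg_left ?_ (Real.rpow_nonneg (hq0 i).le _)
              exact Real.rpow_le_rpow (hq0 i).le (inv_mul_pred_le_half (hd i)) (by linarith)
          _ ≤ _ := by
              refine mul_le_mul_of_nonneg_left ?_ (Real.rpow_nonneg (hq0 i).le _)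
              rw [Real.rpow_def_of_pos (by norm_num), one_div, Real.log_inv, Real.exp_le_exp]
              linarith [hw0 i]
    have hprod : ∏ i ∈ Finset.range n, (if P i then 1 else q i) ≤
        (∏ i ∈ Finset.range n, q i) ^ s *
          Real.exp (∑ i ∈ Finset.range n, w i - (1 - s) * Real.log 2 * n) := by
      have : ∑ i ∈ Finset.range n, w i - (1 - s) * Real.log 2 * n =
          ∑ i ∈ Finset.range n, (w i - (1 - s) * Real.log 2) := by
        rw [Finset.sum_sub_distrib]; simp; ring
      rw [this, Real.exp_sum, ← Real.finsetProd_rpow _ _ fun i _ => (hq0 i).le,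
        ← Finset.prod_mul_distrib]
      refine Finset.prod_le_prod (fun i _ => ?_) fun i _ => hstep i
      split_ifs
      · exact zero_le_one
      · exact (hq0 i).le
    have hMs : M n ^ s ≤ 2 * Real.exp (w (n + 1)) := by
      have h1 : M n ^ s ≤ M n := by
        calc M n ^ s ≤ M n ^ (1 : ℝ) :=
              Real.rpow_le_rpow_of_exponent_le (by linarith [hM2 n]) hs1
          _ = _ := Real.rpow_one _
      refine h1.trans ?_
      simp only [hMdef]
      split_ifs with hP
      · have hDi := hD' (n + 1)
        have h3 : 0 ≤ Real.log (D (n + 1)) := Real.log_nonneg (by linarith)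
        have : (D (n + 1) : ℝ) ≤ Real.exp (w (n + 1)) := by
          rw [← Real.log_le_iff_le_exp (by linarith)]
          linarith [hw _ hP]
        linarith
      · linarith [Real.one_le_exp (hw0 (n + 1))]
    have hQ : 0 ≤ (∏ i ∈ Finset.range n, q i) ^ s :=
      Real.rpow_nonneg (Finset.prod_nonneg fun i _ => (hq0 i).le) _
    calc _ ≤ ((∏ i ∈ Finset.range n, q i) ^ s *
          Real.exp (∑ i ∈ Finset.range n, w i - (1 - s) * Real.log 2 * n)) *
          (2 * Real.exp (w (n + 1))) := by
          refine mul_le_mul hprod hMs (Real.rpow_nonneg (by linarith [hM2 n]) _) ?_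
          exact mul_nonneg hQ (Real.exp_pos _).le
      _ = 2 * Real.exp (∑ i ∈ Finset.range n, w i - (1 - s) * Real.log 2 * n + w (n + 1)) *
          (∏ i ∈ Finset.range n, q i) ^ s := by
          rw [Real.exp_add]; ring
      _ ≤ _ := by
          refine mul_le_mul_of_nonneg_right ?_ hQ
          -- `M n` charges position `n + 1`, so the budget is read at `n + 2`; the two extra terms
          -- are the exponent in `C`.
          have := hsum (n + 2)
          rw [Finset.sum_range_succ, Finset.sum_range_succ] at this
          push_cast at this
          gcongr
          linarith [hw0 n]

end Insert

/-! ### Sparse positions and subexponential `Ψ` -/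

lemma exists_sparse_subset {A : ℕ → Prop} (hA : ∃ᶠ n in atTop, A n) :
    ∃ P : ℕ → Prop, (∀ n, P n → A n) ∧ (∃ᶠ n in atTop, P n) ∧
      ∀ i j, P i → P j → i < j → 2 * i ≤ j := by
  rw [frequently_atTop] at hA
  choose φ hφ hAφ using hA
  let f : ℕ → ℕ := fun k => Nat.rec (φ 0) (fun _ r => φ (2 * r + 1)) k
  have hf (k) : 2 * f k + 1 ≤ f (k + 1) := hφ _
  have hmono : StrictMono f := strictMono_nat_of_lt_succ fun k => by have := hf k; omega
  refine ⟨fun n => ∃ k, f k = n, ?_, ?_, ?_⟩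
  · rintro _ ⟨k, rfl⟩
    cases k with
    | zero => exact hAφ _
    | succ k => exact hAφ _
  · exact frequently_atTop.2 fun k => ⟨f k, hmono.le_apply, k, rfl⟩
  · rintro _ _ ⟨k, rfl⟩ ⟨l, rfl⟩ hkl
    have h1 : k < l := hmono.lt_iff_lt.1 hkl
    have h2 : f (k + 1) ≤ f l := hmono.monotone h1
    have := hf k
    omega

lemma sum_sparse_le {P : ℕ → Prop} [DecidablePred P]
    (hP : ∀ i j, P i → P j → i < j → 2 * i ≤ j) (n : ℕ) :
    ∑ i ∈ Finset.range n, (if P i then (i : ℝ) else 0) ≤ 2 * n := by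
  -- If `n` is the largest position, the earlier ones are at most `n / 2`, so they sum to at most
  -- `n` by induction.
  have key : ∀ n : ℕ, ∀ M : ℝ, 0 ≤ M → (∀ j < n, P j → (j : ℝ) ≤ M) →
      ∑ i ∈ Finset.range n, (if P i then (i : ℝ) else 0) ≤ 2 * M := by
    intro n
    induction n with
    | zero => intro M hM _; simpa using hM
    | succ n ih =>
      intro M hM h
      rw [Finset.sum_range_succ]
      split_ifs with hn
      · have h1 := ih (n / 2) (by positivity) fun j hj hPj => by
          have : (2 * j : ℝ) ≤ n := by exact_mod_cast hP j n hPj hn hj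
          linarith
        linarith [h n (by omega) hn]
      · rw [add_zero]
        exact ih M hM fun j hj => h j (by omega)
  exact key n n (by positivity) fun j hj _ => by exact_mod_cast hj.le

/-- Lower bound for the dimension if `Ψ` is infinitely often subexponential. -/
theorem ofReal_le_dimH_limsupSet_of_subexponential {m : ℕ} (hm : 1 ≤ m) {t : Fin m → ℝ}
    (ht : ∀ i, 0 < t i) {Ψ : ℕ → ℝ} (h :
      ∀ ε : ℝ, 0 < ε → ∃ᶠ n : ℕ in atTop, Ψ n ≤ Real.exp (ε * n))
    {s : ℝ} (hs : 0 < s) (hs1 : s < 1) :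
    ENNReal.ofReal s ≤ dimH (limsupSet t Ψ) := by
  classical
  have ht0 := ht ⟨0, hm⟩
  have hlog2 : 0 < Real.log 2 := Real.log_pos (by norm_num)
  -- Sparse positions below `n` sum to at most `2 * n`, so costs `δ * i` stay within `(1 - s) * log
  -- 2 * n`.
  set δ := (1 - s) * Real.log 2 / 2 with hδ
  have hδ0 : 0 < δ := by
    have : 0 < 1 - s := by linarith
    positivity
  have hA : ∃ᶠ n : ℕ in atTop, ∃ k : ℕ, 3 ≤ k ∧ Ψ (n + 1) ≤ (k : ℝ) ^ t ⟨0, hm⟩ ∧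
      2 * Real.log k + Real.log 2 ≤ δ * n := by
    -- The digit is about `exp (δ * n / 4)`, whose cost `2 * log k` is about `δ * n / 2`; the other
    -- half of `δ * n` absorbs the constants.
    have h1 := h (δ * t ⟨0, hm⟩ / 4) (by positivity)
    rw [← map_add_atTop_eq_nat 1, frequently_map] at h1
    have h2 : ∀ᶠ n : ℕ in atTop, 2 * Real.log 4 + Real.log 2 + δ / 2 ≤ δ / 2 * n :=
      (tendsto_natCast_atTop_atTop.const_mul_atTop (half_pos hδ0)).eventually_ge_atTop _
    refine (h1.and_eventually h2).mono fun n hn => ?_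
    set E := Real.exp (δ / 4 * (n + 1)) with hE
    have hE1 : 1 ≤ E := Real.one_le_exp (by positivity)
    have hc1 := Nat.le_ceil E
    have hc2 := Nat.ceil_lt_add_one (zero_le_one.trans hE1)
    have hc3 := Nat.ceil_pos.2 (zero_lt_one.trans_le hE1)
    refine ⟨⌈E⌉₊ + 2, by omega, hn.1.trans ?_, ?_⟩
    · calc Real.exp (δ * t ⟨0, hm⟩ / 4 * ((n + 1 : ℕ) : ℝ)) = E ^ t ⟨0, hm⟩ := by
            rw [hE, ← Real.exp_mul]; congr 1; push_cast; ring
        _ ≤ _ := by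
            refine Real.rpow_le_rpow (by linarith) ?_ ht0.le
            push_cast
            linarith
    · have : Real.log ((⌈E⌉₊ + 2 : ℕ) : ℝ) ≤ Real.log 4 + δ / 4 * (n + 1) := by
        rw [Real.log_le_iff_le_exp (by positivity), Real.exp_add, Real.exp_log (by norm_num)]
        push_cast
        linarith
      linarith [hn.2]
  obtain ⟨P, hPA, hPf, hPs⟩ := exists_sparse_subset hA
  have hchoose : ∀ n, ∃ k : ℕ, 3 ≤ k ∧ (P n → Ψ (n + 1) ≤ (k : ℝ) ^ t ⟨0, hm⟩ ∧
      2 * Real.log k + Real.log 2 ≤ δ * n) := fun n => by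
    by_cases hn : P n
    · obtain ⟨k, h3, hk⟩ := hPA n hn
      exact ⟨k, h3, fun _ => hk⟩
    · exact ⟨3, le_rfl, fun h => absurd h hn⟩
  choose D hD hDP using hchoose
  refine (le_dimH_image_insertDigit (P := P) hD hs hs1.le
    (w := fun i => δ * if P i then (i : ℝ) else 0) (fun i => ?_) (fun i hi => ?_)
    fun n => ?_).trans (dimH_mono ?_)
  · split_ifs <;> positivity
  · rw [if_pos hi]; exact (hDP i hi).2
  · rw [← Finset.mul_sum]
    have := mul_le_mul_of_nonneg_left (sum_sparse_le hPs n) hδ0.le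
    have e : δ * (2 * n) = (1 - s) * Real.log 2 * n := by rw [hδ]; ring
    linarith
  · rintro _ ⟨x, hx, rfl⟩
    refine lurothSum_mem_limsupSet hm ht (two_le_insertDigit hD hx) (hPf.mono fun n hn => ?_)
    rw [insertDigit, if_pos hn]
    exact (hDP n hn).1

/-! ### Upper bound: covering by cylinders with a large next digit -/

open scoped ENNReal

lemma tsum_fin_prod_eq_pow (f : ℕ → ℝ≥0∞) (n : ℕ) :
    ∑' w : Fin n → ℕ, ∏ i, f (w i) = (∑' k, f k) ^ n := by
  induction n with
  | zero => simp
  | succ n ih =>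
    rw [← (Fin.consEquiv fun _ : Fin (n + 1) => ℕ).tsum_eq, ENNReal.tsum_prod', pow_succ', ← ih,
      ← ENNReal.tsum_mul_right]
    refine tsum_congr fun k => ?_
    rw [← ENNReal.tsum_mul_left]
    refine tsum_congr fun w => ?_
    simp [Fin.prod_univ_succ, Fin.consEquiv]

lemma two_le_digit {x : ℝ} (hx : x ∈ Set.Ioc (0 : ℝ) 1) (n : ℕ) : 2 ≤ digit n x :=
  two_le_firstDigit (iterate_lurothMap_mem hx _)

lemma iterate_lurothMap_sub {x y : ℝ} (hx : x ∈ Set.Ioc (0 : ℝ) 1) (hy : y ∈ Set.Ioc (0 : ℝ) 1)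
    {n : ℕ} (h : ∀ i < n, digit (i + 1) x = digit (i + 1) y) :
    x - y = (∏ i ∈ Finset.range n,
      ((digit (i + 1) x : ℝ) * (digit (i + 1) x - 1))⁻¹) *
        (lurothMap^[n] x - lurothMap^[n] y) := by
  induction n with
  | zero => simp
  | succ n ih =>
    have h1 := eq_firstDigit_add_lurothMap (iterate_lurothMap_mem hx n)
    have h2 := eq_firstDigit_add_lurothMap (iterate_lurothMap_mem hy n)
    have h3 : firstDigit (lurothMap^[n] x) = firstDigit (lurothMap^[n] y) := h n (by omega)
    have h4 : digit (n + 1) x = firstDigit (lurothMap^[n] x) := rfl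
    rw [← h3] at h2
    have h5 : lurothMap^[n] x - lurothMap^[n] y =
        ((firstDigit (lurothMap^[n] x) : ℝ) * (firstDigit (lurothMap^[n] x) - 1))⁻¹ *
          (lurothMap (lurothMap^[n] x) - lurothMap (lurothMap^[n] y)) := by
      linear_combination h1 - h2
    rw [ih fun i hi => h i (by omega), Finset.prod_range_succ, Function.iterate_succ_apply',
      Function.iterate_succ_apply', h4, h5, mul_assoc]

/-- The points whose first `n` digits are `w` and whose next digit is large compared to `w`. -/
def largeDigitCylinder (A c : ℝ) (n : ℕ) (w : Fin n → ℕ) : Set ℝ :=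
  {x | x ∈ Set.Ioc (0 : ℝ) 1 ∧ (∀ i : Fin n, digit (i + 1) x = w i) ∧
    A ^ n * (∏ i, (w i : ℝ)) ^ (c - 1) ≤ digit (n + 1) x}

/-- The prefix gives length at most `2 ^ n * q ^ (-2)` with `q = ∏ w i`, and the large next digit
confines the `n`-th iterate to an interval of length `2 / (A ^ n * q ^ (c - 1))` at 0. -/
lemma abs_sub_le_of_mem_largeDigitCylinder {A c : ℝ} (hA : 0 < A) {n : ℕ} {w : Fin n → ℕ}
    {x y : ℝ} (hx : x ∈ largeDigitCylinder A c n w) (hy : y ∈ largeDigitCylinder A c n w) :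
    |x - y| ≤ 2 * (2 / A) ^ n * ∏ i, (w i : ℝ) ^ (-(c + 1)) := by
  have hw (i : Fin n) : (2 : ℝ) ≤ w i := by
    rw [← hx.2.1 i]; exact_mod_cast two_le_digit hx.1 _
  have hw0 (i : Fin n) : (0 : ℝ) < w i := by linarith [hw i]
  set q : ℝ := ∏ i, (w i : ℝ) with hq
  have hq0 : 0 < q := Finset.prod_pos fun i _ => hw0 i
  have hR : 0 < A ^ n * q ^ (c - 1) := by positivity
  have htail : ∀ z ∈ largeDigitCylinder A c n w,
      0 < lurothMap^[n] z ∧ lurothMap^[n] z ≤ 2 * (A ^ n * q ^ (c - 1))⁻¹ := by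
    intro z hz
    have h1 := iterate_lurothMap_mem hz.1 n
    refine ⟨h1.1, (le_inv_firstDigit_pred h1).trans ?_⟩
    have h2 : (2 : ℝ) ≤ digit (n + 1) z := by exact_mod_cast two_le_digit hz.1 _
    have h3 := hz.2.2
    change ((digit (n + 1) z : ℝ) - 1)⁻¹ ≤ _
    rw [← hq] at h3
    rw [← div_eq_mul_inv, inv_eq_one_div, div_le_div_iff₀ (by linarith) hR]
    linarith
  have hsub := iterate_lurothMap_sub hx.1 hy.1 (n := n) fun i hi =>
    (hx.2.1 ⟨i, hi⟩).trans (hy.2.1 ⟨i, hi⟩).symm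
  have hQ : ∏ i ∈ Finset.range n, ((digit (i + 1) x : ℝ) * (digit (i + 1) x - 1))⁻¹ =
      ∏ i : Fin n, ((w i : ℝ) * (w i - 1))⁻¹ := by
    rw [← Fin.prod_univ_eq_prod_range
      (fun i => ((digit (i + 1) x : ℝ) * (digit (i + 1) x - 1))⁻¹)]
    exact Finset.prod_congr rfl fun i _ => by rw [hx.2.1 i]
  have hQle : ∏ i : Fin n, ((w i : ℝ) * (w i - 1))⁻¹ ≤ 2 ^ n * (q ^ 2)⁻¹ := by
    calc _ ≤ ∏ i : Fin n, 2 * ((w i : ℝ) ^ 2)⁻¹ := by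
          have h1 (i) : 0 < (w i : ℝ) - 1 := by linarith [hw i]
          refine Finset.prod_le_prod (fun i _ => ?_) fun i _ => ?_
          · have := hw0 i; have := h1 i; positivity
          · have := hw0 i
            have := h1 i
            rw [← div_eq_mul_inv, inv_eq_one_div, div_le_div_iff₀ (by positivity) (by positivity)]
            nlinarith [hw i]
      _ = _ := by
          rw [Finset.prod_mul_distrib, Finset.prod_inv_distrib, Finset.prod_pow]; simp [hq]
  have hQ0 : 0 ≤ ∏ i : Fin n, ((w i : ℝ) * (w i - 1))⁻¹ :=
    Finset.prod_nonneg fun i _ => by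
      have := hw i
      exact inv_nonneg.2 (mul_nonneg (by linarith) (by linarith))
  have hx1 := htail x hx
  have hy1 := htail y hy
  rw [hsub, hQ, abs_mul, abs_of_nonneg hQ0]
  calc _ ≤ (2 ^ n * (q ^ 2)⁻¹) * (2 * (A ^ n * q ^ (c - 1))⁻¹) := by
        refine mul_le_mul hQle ?_ (abs_nonneg _) (by positivity)
        rw [abs_le]
        constructor <;> linarith [hx1.1, hx1.2, hy1.1, hy1.2]
    _ = 2 * (2 / A) ^ n * (q ^ 2 * q ^ (c - 1))⁻¹ := by
        rw [div_pow, mul_inv, mul_inv]; ring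
    _ = 2 * (2 / A) ^ n * q ^ (-(c + 1)) := by
        rw [← Real.rpow_natCast q 2, ← Real.rpow_add hq0, Real.rpow_neg hq0.le]
        norm_num
        left; ring_nf
    _ = _ := by rw [hq, Real.finsetProd_rpow _ _ fun i _ => (hw0 i).le]

/-- A set on which infinitely many digits dominate a power of the product of the previous
ones, up to any exponential factor, has small dimension. -/
theorem dimH_le_of_frequently_large_digit {E : Set ℝ} (hE : E ⊆ Set.Ioc 0 1) {c : ℝ}
    {s : NNReal} (hc : 1 ≤ c) (hsc : 1 < s * (c + 1))
    (h : ∀ A : ℝ, 1 ≤ A → ∀ x ∈ E, ∃ᶠ n : ℕ in atTop,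
      A ^ n * (∏ i ∈ Finset.range n, (digit (i + 1) x : ℝ)) ^ (c - 1) ≤ digit (n + 1) x) :
    dimH E ≤ s := by
  have hs0 : 0 < (s : ℝ) := by
    by_contra hs
    nlinarith [s.coe_nonneg]
  set σ := s * (c + 1) with hσ
  set Z : ℝ≥0∞ := ∑' k : ℕ, ENNReal.ofReal ((k : ℝ) ^ (-σ)) with hZ
  have hZtop : Z ≠ ⊤ := by
    have h1 : Summable fun k : ℕ => (k : ℝ) ^ (-σ) := Real.summable_nat_rpow.2 (by linarith)
    exact h1.tsum_ofReal_ne_top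
  -- With `A = 2 * B` the factor `2 ^ n` cancels, and `B` is so large that each further letter at
  -- least halves the sum over words.
  obtain ⟨B, hB2, hB⟩ : ∃ B : ℝ, 2 ≤ B ∧ ENNReal.ofReal (B⁻¹ ^ (s : ℝ)) * Z ≤ 1 / 2 := by
    have hlim : Tendsto (fun B : ℝ => ENNReal.ofReal (B⁻¹ ^ (s : ℝ)) * Z) atTop
        (nhds (ENNReal.ofReal (0 ^ (s : ℝ)) * Z)) := by
      refine ENNReal.Tendsto.mul_const ?_ (Or.inr hZtop)
      exact (ENNReal.continuous_ofReal.tendsto _).comp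
        ((tendsto_inv_atTop_zero).rpow_const (Or.inr hs0.le))
    rw [Real.zero_rpow hs0.ne', ENNReal.ofReal_zero, zero_mul] at hlim
    have h1 := (hlim.eventually_le_const (u := 1 / 2) (by simp)).and
      (eventually_ge_atTop 2)
    obtain ⟨B, hB⟩ := h1.exists
    exact ⟨B, hB.2, hB.1⟩
  have hB0 : 0 < B := by linarith
  have hBA : 2 / (2 * B) = B⁻¹ := by field_simp
  set J := largeDigitCylinder (2 * B) c with hJ
  have hdiam (n : ℕ) (w : Fin n → ℕ) : Metric.ediam (J n w) ≤
      ENNReal.ofReal (2 * B⁻¹ ^ n * ∏ i, (w i : ℝ) ^ (-(c + 1))) := by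
    refine Metric.ediam_le fun x hx y hy => ?_
    rw [edist_dist, Real.dist_eq]
    have := abs_sub_le_of_mem_largeDigitCylinder (by linarith) hx hy
    rw [hBA] at this
    exact ENNReal.ofReal_le_ofReal this
  have hdiam_le (n : ℕ) (w : Fin n → ℕ) :
      Metric.ediam (J n w) ≤ ENNReal.ofReal (2 * B⁻¹ ^ n) := by
    refine (hdiam n w).trans (ENNReal.ofReal_le_ofReal ?_)
    refine mul_le_of_le_one_right (by positivity) ?_
    refine Finset.prod_le_one (fun i _ => by positivity) fun i _ => ?_
    -- Words range over all naturals; a letter 0 contributes `0 ^ (-(c + 1)) = 0`.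
    rcases Nat.eq_zero_or_pos (w i) with h0 | h0
    · rw [h0, Nat.cast_zero, Real.zero_rpow (by linarith)]; exact zero_le_one
    · exact Real.rpow_le_one_of_one_le_of_nonpos (by exact_mod_cast h0) (by linarith)
  have hlevel (n : ℕ) : ∑' w : Fin n → ℕ, Metric.ediam (J n w) ^ (s : ℝ) ≤
      ENNReal.ofReal (2 ^ (s : ℝ)) * (1 / 2) ^ n := by
    calc _ ≤ ∑' w : Fin n → ℕ, ENNReal.ofReal (2 ^ (s : ℝ)) *
          ENNReal.ofReal (B⁻¹ ^ (s : ℝ)) ^ n *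
            ∏ i, ENNReal.ofReal ((w i : ℝ) ^ (-σ)) := by
          refine ENNReal.tsum_le_tsum fun w => ?_
          refine (ENNReal.rpow_le_rpow (hdiam n w) hs0.le).trans (le_of_eq ?_)
          have hp : 0 ≤ ∏ i, (w i : ℝ) ^ (-(c + 1)) :=
            Finset.prod_nonneg fun i _ => by positivity
          rw [ENNReal.ofReal_rpow_of_nonneg (by positivity) hs0.le,
            Real.mul_rpow (by positivity) hp, Real.mul_rpow (by positivity) (by positivity),
            ENNReal.ofReal_mul (by positivity), ENNReal.ofReal_mul (by positivity),
            ← Real.finsetProd_rpow _ _ fun i _ => by positivity,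
            ENNReal.ofReal_prod_of_nonneg fun i _ => by positivity,
            ← ENNReal.ofReal_pow (by positivity)]
          congr 2
          · rw [← Real.rpow_natCast, ← Real.rpow_natCast, ← Real.rpow_mul (by positivity),
              ← Real.rpow_mul (by positivity), mul_comm (s : ℝ)]
          · ext i
            rw [← Real.rpow_mul (by positivity), hσ]
            congr 2; ring
      _ = ENNReal.ofReal (2 ^ (s : ℝ)) * (ENNReal.ofReal (B⁻¹ ^ (s : ℝ)) * Z) ^ n := by
          rw [ENNReal.tsum_mul_left,
            tsum_fin_prod_eq_pow (fun k => ENNReal.ofReal ((k : ℝ) ^ (-σ))), mul_pow, mul_assoc]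
      _ ≤ _ := by gcongr
  refine dimH_le_of_hausdorffMeasure_ne_top (ne_top_of_le_ne_top
    (b := ENNReal.ofReal (2 ^ (s : ℝ)) * 2) (by finiteness) ?_)
  -- The `N`-th covering uses all words of length at least `N`.
  refine (MeasureTheory.Measure.hausdorffMeasure_le_liminf_tsum
    (ι := fun N : ℕ => Σ k : ℕ, Fin (N + k) → ℕ) (l := atTop) (s : ℝ) E
    (fun N => ENNReal.ofReal (2 * B⁻¹ ^ N)) ?_ (fun N p => J (N + p.1) p.2) ?_ ?_).trans ?_
  · have h1 : Tendsto (fun N : ℕ => 2 * B⁻¹ ^ N) atTop (nhds (2 * 0)) :=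
      (tendsto_pow_atTop_nhds_zero_of_lt_one (by positivity)
        (inv_lt_one_of_one_lt₀ (by linarith))).const_mul 2
    rw [mul_zero] at h1
    simpa only [ENNReal.ofReal_zero, Function.comp_def] using
      (ENNReal.continuous_ofReal.tendsto _).comp h1
  · refine Eventually.of_forall fun N p => (hdiam_le _ _).trans (ENNReal.ofReal_le_ofReal ?_)
    refine mul_le_mul_of_nonneg_left ?_ (by norm_num)
    exact pow_le_pow_of_le_one (by positivity) (inv_le_one_of_one_le₀ (by linarith)) (by omega)
  · refine Eventually.of_forall fun N x hx => ?_
    obtain ⟨n, hn, hxn⟩ := frequently_atTop.1 (h (2 * B) (by linarith) x hx) N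
    obtain ⟨k, rfl⟩ := Nat.exists_eq_add_of_le hn
    refine Set.mem_iUnion.2 ⟨⟨k, fun i => digit (i + 1) x⟩, hE hx, fun i => rfl, ?_⟩
    rwa [Fin.prod_univ_eq_prod_range (fun i => (digit (i + 1) x : ℝ))]
  · refine (liminf_le_liminf (v := fun _ => ENNReal.ofReal (2 ^ (s : ℝ)) * 2)
      (Eventually.of_forall fun N => ?_)).trans (liminf_const _).le
    rw [ENNReal.tsum_sigma']
    calc _ ≤ ∑' k : ℕ, ENNReal.ofReal (2 ^ (s : ℝ)) * (1 / 2) ^ k := by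
          refine ENNReal.tsum_le_tsum fun k => (hlevel (N + k)).trans ?_
          refine mul_le_mul_right ?_ _
          exact pow_le_pow_of_le_one zero_le (by simp) (by omega)
      _ = _ := by
          rw [ENNReal.tsum_mul_left, ENNReal.tsum_geometric, one_div, ENNReal.one_sub_inv_two,
            inv_inv]

/-! ### Large digits along points of the limsup set -/

/-- Along the times of large products, `Ψ` is controlled by the size of the digits. -/
lemma frequently_log_le_of_mem_limsupSet {m : ℕ} {t : Fin m → ℝ} (ht : ∀ i, 0 < t i)
    {Ψ : ℕ → ℝ} (hΨ : ∀ n, 1 ≤ n → 0 < Ψ n) {x : ℝ} (hx : x ∈ limsupSet t Ψ) {R : ℕ → ℝ}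
    (hR : ∀ᶠ n in atTop, ∀ i : Fin m, Real.log (digit (n + i) x) ≤ R n) :
    ∃ᶠ n in atTop, Real.log (Ψ n) ≤ (∑ i, t i) * R n := by
  have h := Nat.frequently_atTop_iff_infinite.2 hx.2
  refine (h.and_eventually hR).mono fun n hn => ?_
  obtain ⟨⟨hn1, hn2⟩, hn3⟩ := hn
  have hpos (i : Fin m) : (0 : ℝ) < digit (n + i) x := by
    have := two_le_digit hx.1 (n + i)
    positivity
  refine (Real.log_le_log (hΨ n hn1) hn2).trans ?_
  rw [Real.log_prod fun i _ => (Real.rpow_pos_of_pos (hpos i) _).ne', Finset.sum_mul]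
  refine Finset.sum_le_sum fun i _ => ?_
  rw [Real.log_rpow (hpos i)]
  exact mul_le_mul_of_nonneg_left (hn3 i) (ht i).le

/-- The affine correction `α * n + β` absorbs the term `n * L`: the corrected sequence grows by a
factor of at most `c` per step. -/
lemma exists_le_mul_pow_of_recurrence {ℓ : ℕ → ℝ} {c L : ℝ} (hc : 1 < c) (hL : 0 ≤ L) {N : ℕ}
    (h : ∀ n, N ≤ n → ℓ (n + 1) ≤ c * ℓ n + n * L) :
    ∃ H, 0 ≤ H ∧ ∀ n, N ≤ n → ℓ n ≤ H * c ^ n := by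
  have hc1 : 0 < c - 1 := by linarith
  set α := L / (c - 1) with hα
  set β := α / (c - 1) with hβ
  have hα0 : 0 ≤ α := div_nonneg hL hc1.le
  have hβ0 : 0 ≤ β := div_nonneg hα0 hc1.le
  have eL : L = α * (c - 1) := by rw [hα]; field_simp
  have eα : α = β * (c - 1) := by rw [hβ]; field_simp
  have hcN : 0 < c ^ N := by positivity
  set H := max ((ℓ N + α * N + β) / c ^ N) 0
  have key : ∀ n, N ≤ n → ℓ n + α * n + β ≤ H * c ^ n := by
    intro n hn
    induction n, hn using Nat.le_induction with
    | base =>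
      rw [← div_le_iff₀ hcN]
      exact le_max_left _ _
    | succ n hn ih =>
      have h1 := h n hn
      have h2 := mul_le_mul_of_nonneg_left ih (by linarith : 0 ≤ c)
      push_cast
      have e : c * (ℓ n + α * n + β) = c * ℓ n + n * L + α * (n + 1) + β := by
        rw [eL]; linear_combination -eα
      have e2 : H * c ^ (n + 1) = c * (H * c ^ n) := by ring
      linarith
  refine ⟨H, le_max_right _ _, fun n hn => ?_⟩
  have := key n hn
  have : 0 ≤ α * n := by positivity
  linarith

/-- If `Ψ` grows superexponentially, then every point of the limsup set has infinitely often
digits exceeding any given exponential. -/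
lemma frequently_large_digit_of_superexponential {m : ℕ} {t : Fin m → ℝ} (ht : ∀ i, 0 < t i)
    {Ψ : ℕ → ℝ} (hΨ : ∀ n, 1 ≤ n → 0 < Ψ n)
    (hgrow : ∀ M : ℝ, ∀ᶠ n : ℕ in atTop, M * n ≤ Real.log (Ψ n)) {A : ℝ} (hA : 1 ≤ A) {x : ℝ}
    (hx : x ∈ limsupSet t Ψ) :
    ∃ᶠ n : ℕ in atTop,
      A ^ n * (∏ i ∈ Finset.range n, (digit (i + 1) x : ℝ)) ^ ((1 : ℝ) - 1) ≤
        digit (n + 1) x := by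
  intro hcon
  -- With `c = 1` the product of earlier digits drops out: failure means digits eventually below `A
  -- ^ n`.
  simp only [sub_self, Real.rpow_zero, mul_one, not_le] at hcon
  obtain ⟨N, hN⟩ := eventually_atTop.1 hcon
  have hL : 0 ≤ Real.log A := Real.log_nonneg hA
  have hT : 0 ≤ ∑ i, t i := Finset.sum_nonneg fun i _ => (ht i).le
  have hR : ∀ᶠ n : ℕ in atTop, ∀ i : Fin m, Real.log (digit (n + i) x) ≤
      Real.log A * (m + 1) * n := by
    filter_upwards [eventually_ge_atTop (N + 1)] with n hn i
    obtain ⟨k, rfl⟩ : ∃ k, n = k + 1 := ⟨n - 1, by omega⟩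
    rw [show k + 1 + (i : ℕ) = k + i + 1 by ring]
    have h1 := hN (k + i) (by omega)
    have h2 : (0 : ℝ) < digit (k + i + 1) x := by
      have := two_le_digit hx.1 (k + i + 1)
      positivity
    have h3 := Real.log_le_log h2 h1.le
    rw [Real.log_pow] at h3
    refine h3.trans ?_
    rw [mul_comm, mul_assoc]
    refine mul_le_mul_of_nonneg_left ?_ hL
    have h4 : ((i : ℕ) : ℝ) ≤ m := by exact_mod_cast i.2.le
    push_cast
    nlinarith [(Nat.cast_nonneg k : (0 : ℝ) ≤ k), (Nat.cast_nonneg m : (0 : ℝ) ≤ m)]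
  have hf := frequently_log_le_of_mem_limsupSet ht hΨ hx hR
  refine hf ?_
  filter_upwards [hgrow ((∑ i, t i) * (Real.log A * (m + 1)) + 1), eventually_ge_atTop 1]
    with n hn hn1
  have : (1 : ℝ) ≤ n := by exact_mod_cast hn1
  rw [not_le]
  nlinarith

/-- If `log Ψ` grows at least like `c₂ ^ n`, then every point of the limsup set has infinitely
often digits exceeding the power `c - 1` of the product of the previous ones, for `c < c₂`. -/
lemma frequently_large_digit_of_doubly_exponential {m : ℕ} {t : Fin m → ℝ} (ht : ∀ i, 0 < t i)
    {Ψ : ℕ → ℝ} (hΨ : ∀ n, 1 ≤ n → 0 < Ψ n) {c c₂ : ℝ} (hc : 1 < c) (hcc : c < c₂)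
    (hgrow : ∀ᶠ n : ℕ in atTop, c₂ ^ n ≤ Real.log (Ψ n)) {A : ℝ} (hA : 1 ≤ A) {x : ℝ}
    (hx : x ∈ limsupSet t Ψ) :
    ∃ᶠ n : ℕ in atTop,
      A ^ n * (∏ i ∈ Finset.range n, (digit (i + 1) x : ℝ)) ^ (c - 1) ≤ digit (n + 1) x := by
  intro hcon
  simp only [not_le] at hcon
  obtain ⟨N, hN⟩ := eventually_atTop.1 hcon
  have hL : 0 ≤ Real.log A := Real.log_nonneg hA
  have hd (n) : (2 : ℝ) ≤ digit n x := by exact_mod_cast two_le_digit hx.1 n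
  set ℓ : ℕ → ℝ := fun n => ∑ i ∈ Finset.range n, Real.log (digit (i + 1) x) with hℓ
  have hℓ0 (n) : 0 ≤ ℓ n := Finset.sum_nonneg fun i _ => Real.log_nonneg (by linarith [hd (i + 1)])
  have hstep (n) (hn : N ≤ n) : ℓ (n + 1) ≤ c * ℓ n + n * Real.log A := by
    have hq : 0 < ∏ i ∈ Finset.range n, (digit (i + 1) x : ℝ) :=
      Finset.prod_pos fun i _ => by linarith [hd (i + 1)]
    have h1 := Real.log_le_log (by linarith [hd (n + 1)]) (hN n hn).le
    rw [Real.log_mul (by positivity) (Real.rpow_pos_of_pos hq _).ne', Real.log_pow,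
      Real.log_rpow hq, Real.log_prod fun i _ => by linarith [hd (i + 1)]] at h1
    simp only [hℓ, Finset.sum_range_succ]
    linarith
  obtain ⟨H, hH0, hH⟩ := exists_le_mul_pow_of_recurrence hc hL hstep
  have hc0 : 0 < c := by linarith
  have hR : ∀ᶠ n : ℕ in atTop, ∀ i : Fin m, Real.log (digit (n + i) x) ≤ H * c ^ m * c ^ n := by
    filter_upwards [eventually_ge_atTop (N + 1)] with n hn i
    have h1 := hH (n + i) (by omega)
    have h2 : Real.log (digit (n + i) x) ≤ ℓ (n + i) := by
      obtain ⟨k, hk⟩ : ∃ k, n + (i : ℕ) = k + 1 := ⟨n + i - 1, by omega⟩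
      rw [hk]
      have := hℓ0 k
      simp only [hℓ, Finset.sum_range_succ] at this ⊢
      linarith
    refine h2.trans (h1.trans ?_)
    rw [mul_assoc, ← pow_add]
    refine mul_le_mul_of_nonneg_left ?_ hH0
    exact pow_le_pow_right₀ hc.le (by omega)
  have hf := frequently_log_le_of_mem_limsupSet ht hΨ hx hR
  refine hf ?_
  -- As `c₂ > c`, the growth of `log Ψ` outruns any constant times `c ^ n`, in particular the bound
  -- for `m` consecutive digits.
  have hratio : Tendsto (fun n : ℕ => (c₂ / c) ^ n) atTop atTop :=
    tendsto_pow_atTop_atTop_of_one_lt ((one_lt_div hc0).2 hcc)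
  filter_upwards [hgrow, hratio.eventually_gt_atTop ((∑ i, t i) * (H * c ^ m))] with n h1 h2
  rw [div_pow, lt_div_iff₀ (by positivity)] at h2
  rw [not_le]
  linarith

/-! ### From the indices `B` and `b` to bounds on `Ψ` -/

lemma frequently_le_exp_of_growthB_eq_one {Ψ : ℕ → ℝ} (hΨ : ∀ n, 1 ≤ n → 0 < Ψ n)
    (hB : growthB Ψ = 1) {ε : ℝ} (hε : 0 < ε) :
    ∃ᶠ n : ℕ in atTop, Ψ n ≤ Real.exp (ε * n) := by
  have h1 : growthB Ψ < EReal.exp (ε : EReal) := by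
    rw [hB, EReal.one_lt_exp_iff]
    exact_mod_cast hε
  rw [growthB, EReal.exp_lt_exp_iff] at h1
  refine ((frequently_lt_of_liminf_lt (by isBoundedDefault) h1).and_eventually
    (eventually_ge_atTop 1)).mono fun n hn => ?_
  have hn0 : (0 : ℝ) < n := by exact_mod_cast hn.2
  have h2 : Real.log (Ψ n) / n < ε := by exact_mod_cast hn.1
  rw [div_lt_iff₀ hn0] at h2
  rw [← Real.log_le_iff_le_exp (hΨ n hn.2)]
  exact h2.le

lemma eventually_mul_le_log_of_growthB_eq_top {Ψ : ℕ → ℝ} (hB : growthB Ψ = ⊤) (M : ℝ) :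
    ∀ᶠ n : ℕ in atTop, M * n ≤ Real.log (Ψ n) := by
  have h1 : EReal.exp (M : EReal) < growthB Ψ := by
    rw [hB, EReal.exp_lt_top_iff]
    exact EReal.coe_lt_top M
  rw [growthB, EReal.exp_lt_exp_iff] at h1
  filter_upwards [eventually_lt_of_lt_liminf h1, eventually_ge_atTop 1] with n hn hn1
  have hn0 : (0 : ℝ) < n := by exact_mod_cast hn1
  have h2 : M < Real.log (Ψ n) / n := by exact_mod_cast hn
  rw [lt_div_iff₀ hn0] at h2
  exact h2.le

lemma exp_coe_log {c : ℝ} (hc : 0 < c) :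
    EReal.exp ((Real.log c : ℝ) : EReal) = ENNReal.ofReal c := by
  rw [EReal.exp_coe, Real.exp_log hc]

lemma eventually_pow_le_log_of_lt_growthb {Ψ : ℕ → ℝ} (hB : growthB Ψ = ⊤) {c : ℝ} (hc : 0 < c)
    (h : ENNReal.ofReal c < growthb Ψ) : ∀ᶠ n : ℕ in atTop, c ^ n ≤ Real.log (Ψ n) := by
  rw [← exp_coe_log hc, growthb, EReal.exp_lt_exp_iff] at h
  -- `n ≤ log (Ψ n)` makes `log (Ψ n)` positive, so that the outer logarithm can be inverted.
  filter_upwards [eventually_lt_of_lt_liminf h, eventually_ge_atTop 1,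
    eventually_mul_le_log_of_growthB_eq_top hB 1] with n hn hn1 hn2
  have hn0 : (0 : ℝ) < n := by exact_mod_cast hn1
  have h2 : Real.log c < Real.log (Real.log (Ψ n)) / n := by exact_mod_cast hn
  rw [lt_div_iff₀ hn0, mul_comm, ← Real.log_pow] at h2
  exact ((Real.log_lt_log_iff (by positivity) (by linarith)).1 h2).le

lemma frequently_le_exp_pow_of_growthb_lt {Ψ : ℕ → ℝ} (hΨ : ∀ n, 1 ≤ n → 0 < Ψ n)
    (hB : growthB Ψ = ⊤) {c : ℝ} (hc : 0 < c) (h : growthb Ψ < ENNReal.ofReal c) :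
    ∃ᶠ n : ℕ in atTop, Ψ n ≤ Real.exp (c ^ n) := by
  rw [← exp_coe_log hc, growthb, EReal.exp_lt_exp_iff] at h
  refine ((frequently_lt_of_liminf_lt (by isBoundedDefault) h).and_eventually
    ((eventually_ge_atTop 1).and (eventually_mul_le_log_of_growthB_eq_top hB 1))).mono
    fun n hn => ?_
  obtain ⟨hn, hn1, hn2⟩ := hn
  have hn0 : (0 : ℝ) < n := by exact_mod_cast hn1
  have h2 : Real.log (Real.log (Ψ n)) / n < Real.log c := by exact_mod_cast hn
  rw [div_lt_iff₀ hn0, mul_comm, ← Real.log_pow] at h2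
  rw [← Real.log_le_iff_le_exp (hΨ n hn1)]
  exact ((Real.log_lt_log_iff (by linarith) (by positivity)).1 h2).le

lemma one_le_growthb {Ψ : ℕ → ℝ} (hB : growthB Ψ = ⊤) : 1 ≤ growthb Ψ := by
  rw [growthb, EReal.one_le_exp_iff]
  refine le_liminf_of_le (by isBoundedDefault) ?_
  filter_upwards [eventually_mul_le_log_of_growthB_eq_top hB 1, eventually_ge_atTop 1]
    with n hn hn1
  have hn0 : (1 : ℝ) ≤ n := by exact_mod_cast hn1
  have : 0 ≤ Real.log (Real.log (Ψ n)) / n :=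
    div_nonneg (Real.log_nonneg (by linarith)) (by linarith)
  exact_mod_cast this

/-! ### The dimension when `B = ∞` -/

theorem dimH_limsupSet_le {m : ℕ} {t : Fin m → ℝ} (ht : ∀ i, 0 < t i)
    {Ψ : ℕ → ℝ} (hΨ : ∀ n, 1 ≤ n → 0 < Ψ n) (hB : growthB Ψ = ⊤) :
    dimH (limsupSet t Ψ) ≤ 1 / (growthb Ψ + 1) := by
  have hlarge {c c₂ : ℝ} {s : NNReal} (hc : 1 < c) (hcc : c < c₂)
      (hb : ENNReal.ofReal c₂ < growthb Ψ) (hsc : 1 < s * (c + 1)) :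
      dimH (limsupSet t Ψ) ≤ s :=
    dimH_le_of_frequently_large_digit (fun x hx => hx.1) hc.le hsc fun A hA x hx =>
      frequently_large_digit_of_doubly_exponential ht hΨ hc hcc
        (eventually_pow_le_log_of_lt_growthb hB (by linarith) hb) hA hx
  refine le_of_forall_gt_imp_ge_of_dense fun s hs => ?_
  rcases eq_or_ne s ⊤ with rfl | hs_fin
  · exact le_top
  lift s to NNReal using hs_fin
  rcases eq_or_ne (growthb Ψ) ⊤ with hb | hb
  · have hs0 : (0 : ℝ) < s := by
      rw [hb] at hs
      simpa using hs
    have h2 : 0 < (s : ℝ)⁻¹ := inv_pos.2 hs0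
    -- Any large `c` is allowed; this one gives `s * (c + 1) = 1 + 2 * s`.
    refine hlarge (c := (s : ℝ)⁻¹ + 1) (c₂ := (s : ℝ)⁻¹ + 2) (by linarith) (by linarith)
      (hb ▸ ENNReal.ofReal_lt_top) ?_
    have := mul_inv_cancel₀ hs0.ne'
    linarith
  · have hb1 := one_le_growthb hB
    obtain ⟨b, hb⟩ : ∃ b : NNReal, (b : ℝ≥0∞) = growthb Ψ := ⟨_, ENNReal.coe_toNNReal hb⟩
    rw [← hb] at hb1 hs
    have hb1' : (1 : ℝ) ≤ b := by exact_mod_cast hb1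
    rw [ENNReal.div_lt_iff (Or.inl (by positivity)) (Or.inl (by finiteness))] at hs
    have hs' : (1 : ℝ) < s * (b + 1) := by exact_mod_cast hs
    have hs0 : (0 : ℝ) < s := by
      by_contra h
      nlinarith [s.coe_nonneg]
    -- For `b = 1` there is no `c` strictly between 1 and `b`, so `c = 1` is used. Otherwise `c < c₂
    -- < b` is chosen with `c > 1/s - 1`, that is `s * (c + 1) > 1`.
    rcases hb1'.eq_or_lt with h1 | h1
    · rw [← h1] at hs'
      exact dimH_le_of_frequently_large_digit (fun x hx => hx.1) le_rfl hs' fun A hA x hx =>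
        frequently_large_digit_of_superexponential ht hΨ
          (eventually_mul_le_log_of_growthB_eq_top hB) hA hx
    · have h2 : max 1 ((s : ℝ)⁻¹ - 1) < b := by
        refine max_lt h1 ?_
        rw [sub_lt_iff_lt_add, inv_lt_iff_one_lt_mul₀ hs0]
        linarith
      obtain ⟨c, hc, hcb⟩ := exists_between h2
      obtain ⟨c₂, hc₂, hcb₂⟩ := exists_between hcb
      have hc1 : 1 < c := (le_max_left _ _).trans_lt hc
      have hcs : (s : ℝ)⁻¹ - 1 < c := (le_max_right _ _).trans_lt hc
      refine hlarge hc1 hc₂ ?_ ?_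
      · rw [← hb, ← ENNReal.ofReal_coe_nnreal, ENNReal.ofReal_lt_ofReal_iff (by linarith)]
        exact hcb₂
      · rw [sub_lt_iff_lt_add, inv_lt_iff_one_lt_mul₀ hs0] at hcs
        linarith

theorem le_dimH_limsupSet {m : ℕ} (hm : 1 ≤ m) {t : Fin m → ℝ} (ht : ∀ i, 0 < t i)
    {Ψ : ℕ → ℝ} (hΨ : ∀ n, 1 ≤ n → 0 < Ψ n) (hB : growthB Ψ = ⊤) :
    1 / (growthb Ψ + 1) ≤ dimH (limsupSet t Ψ) := by
  rcases eq_or_ne (growthb Ψ) ⊤ with hb | hb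
  · simp [hb]
  obtain ⟨b, hb⟩ : ∃ b : NNReal, (b : ℝ≥0∞) = growthb Ψ := ⟨_, ENNReal.coe_toNNReal hb⟩
  have hb1 : 1 ≤ b := by
    have := one_le_growthb hB
    rw [← hb] at this
    exact_mod_cast this
  rw [← hb]
  refine le_of_forall_lt_imp_le_of_dense fun a ha => ?_
  have hatop : a ≠ ⊤ := (ha.trans_le le_top).ne
  lift a to NNReal using hatop
  rcases eq_or_ne a 0 with rfl | ha0
  · simp
  have ha0' : (0 : ℝ) < a := by exact_mod_cast pos_iff_ne_zero.2 ha0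
  rw [ENNReal.lt_div_iff_mul_lt (Or.inl (by positivity)) (Or.inl (by finiteness))] at ha
  have ha' : (a : ℝ) * (b + 1) < 1 := by exact_mod_cast ha
  -- Solving `a * (c + 1) < 1` for `c` leaves room above `b`.
  have hba : (b : ℝ) < (a : ℝ)⁻¹ - 1 := by
    rw [lt_sub_iff_add_lt, lt_inv_comm₀ (by positivity) ha0', inv_eq_one_div,
      lt_div_iff₀ (by positivity)]
    exact ha'
  obtain ⟨c, hbc, hca⟩ := exists_between hba
  have hb1' : (1 : ℝ) ≤ b := by exact_mod_cast hb1
  rw [← ENNReal.ofReal_coe_nnreal]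
  refine ofReal_le_dimH_limsupSet hm ht (c := c) (by linarith) ha0' ?_
    (frequently_le_exp_pow_of_growthb_lt hΨ hB (by linarith) ?_)
  · rw [lt_sub_iff_add_lt, lt_inv_comm₀ (by linarith) ha0', inv_eq_one_div,
      lt_div_iff₀ (by linarith)] at hca
    exact hca
  · rw [← hb, ← ENNReal.ofReal_coe_nnreal, ENNReal.ofReal_lt_ofReal_iff (by linarith)]
    exact hbc

end LurothSeries

end

theorem theorem1p5 (m : ℕ) (hm : 1 ≤ m) (t : Fin m → ℝ) (ht : ∀ i, 0 < t i)
    (Ψ : ℕ → ℝ) (hΨ : ∀ n, 1 ≤ n → 0 < Ψ n) :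
    (LurothSeries.growthB Ψ = 1 → dimH (LurothSeries.limsupSet t Ψ) = 1) ∧
    (LurothSeries.growthB Ψ = ⊤ →
      dimH (LurothSeries.limsupSet t Ψ) = 1 / (LurothSeries.growthb Ψ + 1) ∧
      (LurothSeries.growthb Ψ = 1 → dimH (LurothSeries.limsupSet t Ψ) = 1 / 2) ∧
      (LurothSeries.growthb Ψ = ⊤ → dimH (LurothSeries.limsupSet t Ψ) = 0)) := by
  refine ⟨fun hB => le_antisymm ?_ ?_, fun hB => ?_⟩
  · refine (dimH_mono (Set.subset_univ _)).trans ?_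
    rw [Real.dimH_univ]
  · refine le_of_forall_lt_imp_le_of_dense fun a ha => ?_
    have hatop : a ≠ ⊤ := (ha.trans_le le_top).ne
    rcases eq_or_ne a 0 with rfl | ha0
    · exact zero_le
    rw [← ENNReal.ofReal_toReal hatop]
    refine LurothSeries.ofReal_le_dimH_limsupSet_of_subexponential hm ht
      (fun ε hε => LurothSeries.frequently_le_exp_of_growthB_eq_one hΨ hB hε)
      (ENNReal.toReal_pos ha0 hatop) ?_
    rw [← ENNReal.toReal_one]
    exact (ENNReal.toReal_lt_toReal hatop ENNReal.one_ne_top).2 ha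
  · have h := le_antisymm (LurothSeries.dimH_limsupSet_le ht hΨ hB)
      (LurothSeries.le_dimH_limsupSet hm ht hΨ hB)
    refine ⟨h, fun hb => ?_, fun hb => ?_⟩
    · rw [h, hb, one_add_one_eq_two]
    · rw [h, hb]; simp
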